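/- Let $H_1,\dots,H_L$ ($L\ge 1$) be Hermitian matrices acting on a finite-dimensional Hilbert space $\mathcal H$, let $\Lambda:=\max_j\|H_j\|$ with $\|\cdot\|$ the spectral norm, let $t\in\mathbb R$, and let $k\ge 1$, $r\ge 1$ be integers. For $\lambda\in\mathbb C$ put $V(\lambda):=\exp\bigl(\lambda\sum_{j=1}^L H_j\bigr)$, and for $\sigma\in\mathrm{Sym}(L)$ define recursively $$S_2^\sigma(\lambda):=\prod_{j=1}^{L}\exp\Bigl(\frac{\lambda}{2}H_{\sigma(j)}\Bigr)\prod_{j=L}^{1}\exp\Bigl(\frac{\lambda}{2}H_{\sigma(j)}\Bigr),$$ $$S_{2k}^\sigma(\lambda):=[S_{2k-2}^\sigma(p_k\lambda)]^2\,S_{2k-2}^\sigma((1-4p_k)\lambda)\,[S_{2k-2}^\sigma(p_k\lambda)]^2,\qquad p_k:=\frac{1}{4-4^{1/(2k-1)}}\quad(k>1),$$ where products of matrices are written from left to right in the indicated order of $j$. For $\lambda\in i\mathbb R$ let $\mathcal V(\lambda)$ and $\mathcal S_{2k}^\sigma(\lambda)$ be the quantum channels $X\mapsto UXU^\dagger$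 associated with the unitaries $U=V(\lambda)$ and $U=S_{2k}^\sigma(\lambda)$. For a linear map $\mathcal E$ on the matrices on $\mathcal H$, let $\|\mathcal E\|_\diamond:=\max\{\|(\mathcal E\otimes\mathbb 1_{\mathcal H})(Y)\|_1:\|Y\|_1\le 1\}$ be its diamond norm, where $Y$ ranges over the matrices on $\mathcal H\otimes\mathcal H$ and $\|\cdot\|_1$ is the trace norm (the sum of the singular values). Then $$\Biggl\|\mathcal V(-it)-\biggl(\frac{1}{L!}\sum_{\sigma\in\mathrm{Sym}(L)}\mathcal S_{2k}^\sigma(-it/r)\biggr)^r\Biggr\|_\diamond\le 4\,\frac{(2\cdot5^{k-1}\Lambda|t|L)^{4k+2}}{\bigl((2k+1)!\bigr)^2r^{4k+1}}\exp\Bigl(4\cdot5^{k-1}\frac{\Lambda|t|L}{r}\Bigr)+2\,\frac{(2\cdot5^{k-1}\Lambda|t|)^{2k+1}L^{2k}}{(2k-1)!\,r^{2k}}\exp\Bigl(2\cdot5^{k-1}\frac{\Lambda|t|L}{r}\Bigr).$$ -/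

import Mathlib

open scoped Matrix Kronecker Nat

noncomputable section

namespace ProductFormula

variable {n : Type*} [Fintype n] [DecidableEq n]

/-- The spectral norm of a matrix: its operator norm on Euclidean space. -/
def spectralNorm (A : Matrix n n ℂ) : ℝ :=
  ‖Matrix.toEuclideanCLM (n := n) (𝕜 := ℂ) A‖

/-- The trace norm (Schatten 1-norm) of a matrix: the sum of its singular values.
Mathlib lists the singular values, with multiplicity, as a finitely supported sequence. -/
def traceNorm (A : Matrix n n ℂ) : ℝ :=
  (Matrix.toEuclideanLin A).singularValues.sum fun _ s => s

theorem sum_sq_singularValues (A : Matrix n n ℂ) :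
    ∑ i ∈ Finset.range (Fintype.card n), (Matrix.toEuclideanLin A).singularValues i ^ 2 =
      ∑ i, ∑ j, ‖A i j‖ ^ 2 := by
  have hn : Module.finrank ℂ (EuclideanSpace ℂ n) = Fintype.card n := finrank_euclideanSpace
  set T := Matrix.toEuclideanLin A with hT
  have h1 := T.isSymmetric_adjoint_comp_self.trace_eq_sum_eigenvalues hn
  rw [Finset.sum_range]
  simp_rw [T.sq_singularValues_fin hn]
  have h2 : LinearMap.trace ℂ _ (LinearMap.adjoint T ∘ₗ T) = ((∑ i, ∑ j, ‖A i j‖^2 : ℝ) : ℂ) := by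
    rw [hT, ← Matrix.toEuclideanLin_conjTranspose_eq_adjoint,
      LinearMap.trace_eq_matrix_trace ℂ (EuclideanSpace.basisFun n ℂ).toBasis]
    rw [LinearMap.toMatrix_comp _ (EuclideanSpace.basisFun n ℂ).toBasis]
    simp only [Matrix.toEuclideanLin_eq_toLin_orthonormal, LinearMap.toMatrix_toLin]
    rw [Finset.sum_comm]
    push_cast
    simp [Matrix.trace, Matrix.mul_apply, Complex.conj_mul']
  rw [h2] at h1
  exact Complex.ofReal_injective h1.symm

theorem traceNorm_eq_sum (A : Matrix n n ℂ) :
    traceNorm A = ∑ i ∈ Finset.range (Fintype.card n), (Matrix.toEuclideanLin A).singularValues i := by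
  unfold traceNorm
  apply Finsupp.sum_of_support_subset _ _ _ (by simp)
  intro i hi
  by_contra h
  simp only [Finset.mem_range, not_lt] at h
  exact (Finsupp.mem_support_iff.1 hi) (LinearMap.singularValues_of_finrank_le _ (by simpa using h))

theorem traceNorm_nonneg (A : Matrix n n ℂ) : 0 ≤ traceNorm A := by
  rw [traceNorm_eq_sum]; exact Finset.sum_nonneg fun i _ => LinearMap.singularValues_nonneg _ _

theorem norm_entry_le_traceNorm (A : Matrix n n ℂ) (i j : n) : ‖A i j‖ ≤ traceNorm A := by
  refine le_of_sq_le_sq ?_ (traceNorm_nonneg A)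
  calc ‖A i j‖^2 ≤ ∑ j, ‖A i j‖^2 :=
        Finset.single_le_sum (f := fun j => ‖A i j‖^2) (fun _ _ => by positivity) (Finset.mem_univ j)
    _ ≤ ∑ i, ∑ j, ‖A i j‖^2 :=
        Finset.single_le_sum (f := fun i => ∑ j, ‖A i j‖^2) (fun _ _ => by positivity) (Finset.mem_univ i)
    _ ≤ _ := by
      rw [← sum_sq_singularValues, traceNorm_eq_sum]
      exact Finset.sum_sq_le_sq_sum_of_nonneg fun i _ => LinearMap.singularValues_nonneg _ _

theorem traceNorm_sq_le (A : Matrix n n ℂ) :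
    traceNorm A ^ 2 ≤ Fintype.card n * ∑ i, ∑ j, ‖A i j‖^2 := by
  rw [← sum_sq_singularValues, traceNorm_eq_sum]
  simpa using sq_sum_le_card_mul_sum_sq (s := Finset.range (Fintype.card n))
    (f := fun i => (Matrix.toEuclideanLin A).singularValues i)

/-- The map `E ⊗ 1` on matrices over `n × n`: `E` acts on the first tensor factor. -/
def tensorId (E : Module.End ℂ (Matrix n n ℂ)) : Module.End ℂ (Matrix (n × n) (n × n) ℂ) where
  toFun Y := Matrix.of fun p q => E (Matrix.of fun i j => Y (i, p.2) (j, q.2)) p.1 q.1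
  map_add' Y Z := by
    ext p q
    exact congrFun (congrFun (map_add E (Matrix.of fun i j => Y (i, p.2) (j, q.2))
      (Matrix.of fun i j => Z (i, p.2) (j, q.2))) p.1) q.1
  map_smul' c Y := by
    ext p q
    exact congrFun (congrFun (map_smul E c (Matrix.of fun i j => Y (i, p.2) (j, q.2))) p.1) q.1

/-- The defining property of `E ⊗ 1`: on product matrices, `(E ⊗ 1)(A ⊗ B) = E(A) ⊗ B`. -/
theorem tensorId_kronecker {m : Type*} (E : Module.End ℂ (Matrix m m ℂ)) (A B : Matrix m m ℂ) :
    tensorId E (A ⊗ₖ B) = E A ⊗ₖ B := by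
  ext p q
  have h : (Matrix.of fun i j => (A ⊗ₖ B) (i, p.2) (j, q.2)) = B p.2 q.2 • A := by
    ext i j
    simp [mul_comm]
  change E (Matrix.of fun i j => (A ⊗ₖ B) (i, p.2) (j, q.2)) p.1 q.1 = _
  rw [h, map_smul]
  simp [mul_comm]

/-- The diamond norm of a linear map `E` on matrices:
the maximum of `‖(E ⊗ 1)(Y)‖₁` over all `Y` with `‖Y‖₁ ≤ 1`. -/
def diamondNorm (E : Module.End ℂ (Matrix n n ℂ)) : ℝ :=
  sSup {x : ℝ | ∃ Y : Matrix (n × n) (n × n) ℂ, traceNorm Y ≤ 1 ∧ x = traceNorm (tensorId E Y)}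

/-- The set in the definition of the diamond norm is bounded, so its `sSup` is a true supremum. -/
theorem bddAbove_diamondNorm (E : Module.End ℂ (Matrix n n ℂ)) :
    BddAbove {x : ℝ | ∃ Y : Matrix (n × n) (n × n) ℂ, traceNorm Y ≤ 1 ∧
      x = traceNorm (tensorId E Y)} := by
  set T := tensorId E
  let C : ℝ := Fintype.card (n × n) * ∑ p, ∑ q, (∑ a, ∑ b, ‖T (Matrix.single a b 1) p q‖)^2
  refine ⟨√ C, ?_⟩
  rintro x ⟨Y, hY, rfl⟩
  refine Real.le_sqrt_of_sq_le ((traceNorm_sq_le _).trans ?_)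
  simp only [C]
  gcongr with p _ q _
  conv_lhs => rw [Matrix.matrix_eq_sum_single Y]
  simp only [map_sum, Matrix.sum_apply]
  refine (norm_sum_le _ _).trans (Finset.sum_le_sum fun a _ =>
    (norm_sum_le _ _).trans (Finset.sum_le_sum fun b _ => ?_))
  have : Matrix.single a b (Y a b) = Y a b • Matrix.single a b 1 := by simp
  rw [this, map_smul, Matrix.smul_apply, norm_smul]
  exact mul_le_of_le_one_left (norm_nonneg _) ((norm_entry_le_traceNorm Y a b).trans hY)

/-- The channel `X ↦ U X U†` associated with a unitary matrix `U`. -/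
def channel (U : Matrix n n ℂ) : Module.End ℂ (Matrix n n ℂ) :=
  LinearMap.mulLeft ℂ U ∘ₗ LinearMap.mulRight ℂ Uᴴ

theorem channel_apply (U X : Matrix n n ℂ) : channel U X = U * X * Uᴴ := by
  simp [channel, mul_assoc]

/-- The ideal evolution `V(z) = exp(z ∑ⱼ Hⱼ)`. -/
def idealEvolution {L : ℕ} (H : Fin L → Matrix n n ℂ) (z : ℂ) : Matrix n n ℂ :=
  NormedSpace.exp (z • ∑ j, H j)

/-- The coefficient `p_k = 1 / (4 - 4 ^ (1 / (2k - 1)))`, used for `k ≥ 2`. -/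
def suzukiCoeff (k : ℕ) : ℝ := 1 / (4 - (4 : ℝ) ^ (1 / (2 * (k : ℝ) - 1)))

/-- The second-order formula
`S₂^σ(z) = ∏_{j=1}^L exp((z/2) H_{σ(j)}) ∏_{j=L}^1 exp((z/2) H_{σ(j)})`
(ordered products, written from left to right). -/
def suzukiTwo {L : ℕ} (H : Fin L → Matrix n n ℂ) (σ : Equiv.Perm (Fin L)) (z : ℂ) :
    Matrix n n ℂ :=
  (List.ofFn fun j => NormedSpace.exp ((z / 2) • H (σ j))).prod *
    (List.ofFn fun j => NormedSpace.exp ((z / 2) • H (σ j))).reverse.prod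

/-- `suzuki H σ k z` is the permuted `(2k)`th-order formula `S_{2k}^σ(z)`, for `k ≥ 1`
(the value at `k = 0` is a placeholder). -/
def suzuki {L : ℕ} (H : Fin L → Matrix n n ℂ) (σ : Equiv.Perm (Fin L)) :
    ℕ → ℂ → Matrix n n ℂ
  | 0, _ => 1
  | 1, z => suzukiTwo H σ z
  | k + 2, z =>
      suzuki H σ (k + 1) ((suzukiCoeff (k + 2) : ℂ) * z) ^ 2 *
        suzuki H σ (k + 1) ((1 - 4 * (suzukiCoeff (k + 2) : ℂ)) * z) *
        suzuki H σ (k + 1) ((suzukiCoeff (k + 2) : ℂ) * z) ^ 2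

/-- The average channel `(1 / L!) ∑_σ 𝒮_{2k}^σ(z)` over all permutations `σ` of the summands. -/
def averageChannel {L : ℕ} (H : Fin L → Matrix n n ℂ) (k : ℕ) (z : ℂ) :
    Module.End ℂ (Matrix n n ℂ) :=
  (1 / (L ! : ℂ)) • ∑ σ : Equiv.Perm (Fin L), channel (suzuki H σ k z)

end ProductFormula

end

/-!
The channel of the ideal evolution factors into `r` equal steps, and both the exact step and the
averaged product formula are contractive, so it is enough to bound the error of one step by
`a² + 2b` and to multiply by `r`. Here `a` bounds `‖S^σ - V‖` for every single ordering `σ`, and `b`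
bounds the norm of the average of `S^σ - V` over all orderings. This mixing lemma
(`diamondNorm_channel_pow_sub_average_pow_le`) is an identity for
`V Y V† - avg (V + δ_σ) Y (V + δ_σ)†` together with Hölder's inequality for the trace norm, which
comes from the duality with the spectral norm (`norm_trace_mul_le`,
`exists_trace_mul_eq_traceNorm`); tensoring with the identity does not increase spectral norms
because it is a homomorphism of C⋆-algebras.

For `a` and `b` the product formula is expanded as a formal power series in `z`, whose coefficients
live in an arbitrary real algebra generated by the summands.

* *Order.* `S_{2k}` and the exponential agree up to order `2k` (`coeff_formalSuzuki_eq`): the Suzuki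
  coefficient cancels the leading error of odd order of the five factors, and the symmetry
  `S(z) S(-z) = 1` excludes a leading error of even order.
* *Size.* In the free algebra, realized as the monoid algebra of words, the formula `S_{2k}` is
  dominated coefficientwise by `S₂ ^ 5^(k-1)`, whose coefficients are nonnegative. Functionals of
  words that ignore the order of the letters factor through the abelianization, where products of
  exponentials merge. They take the same values on the `s`-th coefficient of the majorant and on
  `5^((k-1)s) (∑ xⱼ)ˢ / s!` (`pairing_majorant`).
* *Averaging.* The average of a word over all permutations of the letters is the same for all words
  of a given length without repeated letters. Hence the contribution of these words factors
  through the abelianization, where every product formula is exact, and it cancels against that of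
  the exponential. Only the at most `C(s,2) L^(s-1)` words of length `s` with a repeated letter are
  left, which saves the factor `1 / L` in `b` (`norm_average_coeff_sub_le`).

The coefficient bounds are summed to remainder estimates in any complex Banach algebra
(`norm_banachSuzuki_sub_exp_le`, `norm_average_banachSuzuki_sub_exp_le`). All of this holds with
`5^(k-1)` in place of the `2 * 5^(k-1)` of the final bound.
-/

noncomputable section

namespace ProductFormula

section TraceNorm

variable {n : Type*} [Fintype n] [DecidableEq n]

open scoped Matrix.Norms.L2Operator InnerProductSpace

/-! ### Trace norm duality -/

theorem trace_eq_trace_toEuclideanLin (A : Matrix n n ℂ) :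
    A.trace = LinearMap.trace ℂ _ (Matrix.toEuclideanLin A) := by
  rw [LinearMap.trace_eq_matrix_trace ℂ (EuclideanSpace.basisFun n ℂ).toBasis,
    Matrix.toEuclideanLin_eq_toLin_orthonormal, LinearMap.toMatrix_toLin]

theorem toEuclideanLin_mul_apply (A B : Matrix n n ℂ) (x : EuclideanSpace ℂ n) :
    Matrix.toEuclideanLin (A * B) x = Matrix.toEuclideanLin A (Matrix.toEuclideanLin B x) := by
  simp [← Matrix.coe_toEuclideanCLM_eq_toEuclideanLin]

/-- An orthonormal basis of right singular vectors of `A`, with singular values `s`. -/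
theorem exists_rightSingularBasis (A : Matrix n n ℂ) :
    ∃ (b : OrthonormalBasis (Fin (Fintype.card n)) ℂ (EuclideanSpace ℂ n))
      (s : Fin (Fintype.card n) → ℝ),
      traceNorm A = ∑ i, s i ∧ (∀ i, 0 ≤ s i) ∧
      ∀ i j, ⟪Matrix.toEuclideanLin A (b i), Matrix.toEuclideanLin A (b j)⟫_ℂ =
        if i = j then (s i : ℂ) ^ 2 else 0 := by
  have hn : Module.finrank ℂ (EuclideanSpace ℂ n) = Fintype.card n := finrank_euclideanSpace
  set T := Matrix.toEuclideanLin A with hT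
  refine ⟨T.isSymmetric_adjoint_comp_self.eigenvectorBasis hn, fun i => T.singularValues i,
    ?_, fun i => T.singularValues_nonneg i, fun i j => ?_⟩
  · rw [traceNorm_eq_sum, Finset.sum_range]
  · rw [← LinearMap.adjoint_inner_right, ← LinearMap.comp_apply,
      LinearMap.IsSymmetric.apply_eigenvectorBasis, inner_smul_right,
      OrthonormalBasis.inner_eq_ite]
    split_ifs with h
    · subst h
      rw [← T.sq_singularValues_fin hn]
      simp
    · simp

/-- Hölder's inequality between the spectral and the trace norm. -/
theorem norm_trace_mul_le (B A : Matrix n n ℂ) : ‖(B * A).trace‖ ≤ ‖B‖ * traceNorm A := by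
  obtain ⟨b, s, hs, hs0, hb⟩ := exists_rightSingularBasis A
  rw [trace_eq_trace_toEuclideanLin, LinearMap.trace_eq_sum_inner _ b, hs, Finset.mul_sum]
  refine norm_sum_le_of_le _ fun i _ => (norm_inner_le_norm _ _).trans ?_
  have h1 : ‖Matrix.toEuclideanLin A (b i)‖ = s i := by
    have h := hb i i
    rw [inner_self_eq_norm_sq_to_K, if_pos rfl] at h
    have h' : ‖Matrix.toEuclideanLin A (b i)‖ ^ 2 = s i ^ 2 := by
      apply Complex.ofReal_injective
      simpa using h
    exact (sq_eq_sq₀ (norm_nonneg _) (hs0 i)).1 h'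
  rw [b.norm_eq_one, one_mul, toEuclideanLin_mul_apply, ← h1]
  exact (Matrix.toEuclideanCLM (n := n) (𝕜 := ℂ) B).le_opNorm _

/-- The trace norm is attained in the duality with the spectral norm: the contraction is the
adjoint of the partial isometry in the polar decomposition of `A`. -/
theorem exists_trace_mul_eq_traceNorm (A : Matrix n n ℂ) :
    ∃ B : Matrix n n ℂ, ‖B‖ ≤ 1 ∧ (B * A).trace = traceNorm A := by
  obtain ⟨b, s, hs, hs0, hb⟩ := exists_rightSingularBasis A
  set T := Matrix.toEuclideanLin A with hT
  let u : Fin (Fintype.card n) → EuclideanSpace ℂ n := fun i => ((s i : ℂ)⁻¹) • T (b i)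
  let U : EuclideanSpace ℂ n →L[ℂ] EuclideanSpace ℂ n :=
    ∑ i, (innerSL ℂ (u i)).smulRight (b i)
  have hU : ∀ x, U x = ∑ i, ⟪u i, x⟫_ℂ • b i := fun x => by simp [U]
  have hu : Orthonormal ℂ fun i : {i // s i ≠ 0} => u i := by
    rw [orthonormal_iff_ite]
    rintro ⟨i, hi⟩ ⟨j, hj⟩
    simp only [u, inner_smul_left, inner_smul_right, hb, Subtype.mk.injEq]
    have : (s i : ℂ) ≠ 0 := by exact_mod_cast hi
    split_ifs with h
    · subst h; simp; field_simp
    · simp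
  have hU1 : ‖U‖ ≤ 1 := by
    refine U.opNorm_le_bound zero_le_one fun x => ?_
    rw [one_mul]
    refine le_of_sq_le_sq ?_ (norm_nonneg _)
    have h1 : ‖U x‖ ^ 2 = ∑ i, ‖⟪u i, x⟫_ℂ‖ ^ 2 := by
      rw [← b.sum_sq_norm_inner_right]
      refine Finset.sum_congr rfl fun i _ => ?_
      rw [hU, inner_sum]
      simp [inner_smul_right, b.inner_eq_ite]
    rw [h1]
    refine le_trans (le_of_eq ?_) (hu.sum_inner_products_le (s := Finset.univ) x)
    have h2 : ∀ i, i ∉ Finset.univ.filter (fun i => s i ≠ 0) → ‖⟪u i, x⟫_ℂ‖ ^ 2 = 0 := by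
      intro i hi
      have : s i = 0 := by simpa using hi
      simp [u, this]
    rw [← Finset.sum_subset (Finset.subset_univ _) fun i _ hi => h2 i hi]
    exact Finset.sum_subtype _ (by simp) _
  refine ⟨(Matrix.toEuclideanCLM (n := n) (𝕜 := ℂ)).symm U, ?_, ?_⟩
  · rw [Matrix.cstar_norm_def]
    simpa using hU1
  · rw [trace_eq_trace_toEuclideanLin, LinearMap.trace_eq_sum_inner _ b, hs]
    push_cast
    refine Finset.sum_congr rfl fun i _ => ?_
    rw [toEuclideanLin_mul_apply, ← hT, ← Matrix.coe_toEuclideanCLM_eq_toEuclideanLin]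
    simp [hU, inner_smul_right, u, hb]
    by_cases h : s i = 0
    · simp [h]
    · field_simp

theorem traceNorm_add_le (A B : Matrix n n ℂ) : traceNorm (A + B) ≤ traceNorm A + traceNorm B := by
  obtain ⟨C, hC, h⟩ := exists_trace_mul_eq_traceNorm (A + B)
  have h1 := norm_trace_mul_le C A
  have h2 := norm_trace_mul_le C B
  have h3 : ‖(C * (A + B)).trace‖ = traceNorm (A + B) := by
    rw [h, Complex.norm_real, Real.norm_of_nonneg (traceNorm_nonneg _)]
  rw [mul_add, Matrix.trace_add] at h3
  rw [← h3]
  refine (norm_add_le _ _).trans (add_le_add (h1.trans ?_) (h2.trans ?_)) <;>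
    exact mul_le_of_le_one_left (traceNorm_nonneg _) hC

theorem traceNorm_mul_le_left (A B : Matrix n n ℂ) :
    traceNorm (A * B) ≤ ‖A‖ * traceNorm B := by
  obtain ⟨C, hC, h⟩ := exists_trace_mul_eq_traceNorm (A * B)
  have h3 : ‖(C * (A * B)).trace‖ = traceNorm (A * B) := by
    rw [h, Complex.norm_real, Real.norm_of_nonneg (traceNorm_nonneg _)]
  rw [← h3, ← mul_assoc]
  refine (norm_trace_mul_le _ _).trans (mul_le_mul_of_nonneg_right ?_ (traceNorm_nonneg _))
  exact (norm_mul_le _ _).trans (mul_le_of_le_one_left (norm_nonneg _) hC)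

theorem traceNorm_mul_le_right (A B : Matrix n n ℂ) :
    traceNorm (A * B) ≤ traceNorm A * ‖B‖ := by
  obtain ⟨C, hC, h⟩ := exists_trace_mul_eq_traceNorm (A * B)
  have h3 : ‖(C * (A * B)).trace‖ = traceNorm (A * B) := by
    rw [h, Complex.norm_real, Real.norm_of_nonneg (traceNorm_nonneg _)]
  rw [← h3, ← mul_assoc, Matrix.trace_mul_comm, ← mul_assoc, mul_comm (traceNorm A)]
  refine (norm_trace_mul_le _ _).trans (mul_le_mul_of_nonneg_right ?_ (traceNorm_nonneg _))
  exact (norm_mul_le _ _).trans (mul_le_of_le_one_right (norm_nonneg _) hC)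

theorem traceNorm_smul_le (c : ℂ) (A : Matrix n n ℂ) : traceNorm (c • A) ≤ ‖c‖ * traceNorm A := by
  obtain ⟨C, hC, h⟩ := exists_trace_mul_eq_traceNorm (c • A)
  have h3 : ‖(C * (c • A)).trace‖ = traceNorm (c • A) := by
    rw [h, Complex.norm_real, Real.norm_of_nonneg (traceNorm_nonneg _)]
  rw [← h3, Matrix.mul_smul, Matrix.trace_smul, norm_smul]
  refine mul_le_mul_of_nonneg_left ((norm_trace_mul_le _ _).trans ?_) (norm_nonneg _)
  exact mul_le_of_le_one_left (traceNorm_nonneg _) hC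

@[simp] theorem traceNorm_zero : traceNorm (0 : Matrix n n ℂ) = 0 :=
  le_antisymm (by simpa using traceNorm_smul_le 0 (0 : Matrix n n ℂ)) (traceNorm_nonneg _)

theorem traceNorm_sum_le {α : Type*} (s : Finset α) (f : α → Matrix n n ℂ) :
    traceNorm (∑ a ∈ s, f a) ≤ ∑ a ∈ s, traceNorm (f a) :=
  Finset.le_sum_of_subadditive _ traceNorm_zero.le traceNorm_add_le s f

theorem traceNorm_mul_mul_le (A Y B : Matrix n n ℂ) :
    traceNorm (A * Y * B) ≤ ‖A‖ * ‖B‖ * traceNorm Y := by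
  refine (traceNorm_mul_le_right _ _).trans ?_
  rw [mul_right_comm]
  exact mul_le_mul_of_nonneg_right (traceNorm_mul_le_left _ _) (norm_nonneg _)

/-! ### Extending channels by the identity -/

theorem tensorId_mul {m : Type*} (E F : Module.End ℂ (Matrix m m ℂ)) :
    tensorId (E * F) = tensorId E * tensorId F := rfl

theorem tensorId_add {m : Type*} (E F : Module.End ℂ (Matrix m m ℂ)) :
    tensorId (E + F) = tensorId E + tensorId F := rfl

theorem tensorId_sub {m : Type*} (E F : Module.End ℂ (Matrix m m ℂ)) :
    tensorId (E - F) = tensorId E - tensorId F := rfl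

theorem tensorId_smul {m : Type*} (c : ℂ) (E : Module.End ℂ (Matrix m m ℂ)) :
    tensorId (c • E) = c • tensorId E := rfl

theorem tensorId_sum {m : Type*} {α : Type*} (s : Finset α) (E : α → Module.End ℂ (Matrix m m ℂ)) :
    tensorId (∑ a ∈ s, E a) = ∑ a ∈ s, tensorId (E a) :=
  map_sum (⟨⟨tensorId, rfl⟩, tensorId_add⟩ : _ →+ Module.End ℂ (Matrix (m × m) (m × m) ℂ)) E s

theorem tensorId_pow {m : Type*} (E : Module.End ℂ (Matrix m m ℂ)) (r : ℕ) :
    tensorId (E ^ r) = tensorId E ^ r := by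
  induction r with
  | zero => rfl
  | succ r ih => rw [pow_succ, pow_succ, tensorId_mul, ih]

theorem tensorId_channel (U : Matrix n n ℂ) :
    tensorId (channel U) = channel (U ⊗ₖ (1 : Matrix n n ℂ)) := by
  ext1 Y
  ext ⟨a, b⟩ ⟨c, d⟩
  rw [channel_apply]
  change channel U (Matrix.of fun i j => Y (i, b) (j, d)) a c = _
  rw [channel_apply]
  simp [Matrix.mul_apply, Fintype.sum_prod_type, Matrix.kroneckerMap_apply, Matrix.one_apply,
    apply_ite (starRingEnd ℂ)]

/-- Tensoring with the identity, as a homomorphism of C⋆-algebras. -/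
def kroneckerOne : Matrix n n ℂ →⋆ₐ[ℂ] Matrix (n × n) (n × n) ℂ where
  toFun A := A ⊗ₖ (1 : Matrix n n ℂ)
  map_one' := Matrix.one_kronecker_one
  map_mul' A B := by rw [← Matrix.mul_kronecker_mul, one_mul]
  map_zero' := Matrix.zero_kronecker _
  map_add' A B := Matrix.add_kronecker _ _ _
  commutes' c := by
    rw [Algebra.algebraMap_eq_smul_one, Algebra.algebraMap_eq_smul_one, Matrix.smul_kronecker,
      Matrix.one_kronecker_one]
  map_star' A := by
    simp [Matrix.star_eq_conjTranspose, Matrix.conjTranspose_kronecker]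

theorem norm_kroneckerOne_le (A : Matrix n n ℂ) : ‖kroneckerOne A‖ ≤ ‖A‖ :=
  NonUnitalStarAlgHom.norm_apply_le (kroneckerOne (n := n)) A

theorem norm_le_one_of_mem_unitary {U : Matrix n n ℂ}
    (hU : U ∈ unitary (Matrix n n ℂ)) : ‖U‖ ≤ 1 := by
  cases isEmpty_or_nonempty n
  · rw [Subsingleton.elim U 0]; simp
  · exact (CStarRing.norm_of_mem_unitary hU).le

/-! ### Mixing unitary channels -/

theorem channel_mul (U V : Matrix n n ℂ) : channel (U * V) = channel U * channel V := by
  ext1 X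
  simp [channel_apply, mul_assoc]

theorem channel_pow (U : Matrix n n ℂ) (r : ℕ) : channel (U ^ r) = channel U ^ r := by
  induction r with
  | zero => ext1 X; simp [channel_apply]
  | succ r ih => rw [pow_succ, pow_succ, channel_mul, ih]

theorem traceNorm_channel_le {U : Matrix n n ℂ} (hU : ‖U‖ ≤ 1) (Y : Matrix n n ℂ) :
    traceNorm (channel U Y) ≤ traceNorm Y := by
  rw [channel_apply]
  refine (traceNorm_mul_mul_le _ _ _).trans (mul_le_of_le_one_left (traceNorm_nonneg _) ?_)
  rw [Matrix.l2_opNorm_conjTranspose]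
  exact mul_le_one₀ hU (norm_nonneg _) hU

/-- Averages of contractive channels are contractive. -/
theorem traceNorm_average_channel_le {α : Type*} [Fintype α] [Nonempty α]
    (U : α → Matrix n n ℂ) (hU : ∀ a, ‖U a‖ ≤ 1) (Y : Matrix n n ℂ) :
    traceNorm (((1 / (Fintype.card α : ℂ)) • ∑ a, channel (U a)) Y) ≤ traceNorm Y := by
  rw [LinearMap.smul_apply, LinearMap.sum_apply]
  refine (traceNorm_smul_le _ _).trans ?_
  have h : traceNorm (∑ a, channel (U a) Y) ≤ Fintype.card α * traceNorm Y := by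
    refine (traceNorm_sum_le _ _).trans ?_
    refine (Finset.sum_le_card_nsmul _ _ _ fun a _ => traceNorm_channel_le (hU a) Y).trans ?_
    simp
  refine (mul_le_mul_of_nonneg_left h (norm_nonneg _)).trans (le_of_eq ?_)
  simp

/-- The mixing lemma: the average of the channels of unitaries `U a` approximates the channel of
`V` to an accuracy that is quadratic in the individual errors `U a - V` and linear only in the
error of the average of the `U a`. -/
theorem traceNorm_channel_sub_average_le {α : Type*} [Fintype α] [Nonempty α]
    (U : α → Matrix n n ℂ) (V : Matrix n n ℂ) (hV : ‖V‖ ≤ 1) {a b : ℝ}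
    (ha : ∀ x, ‖U x - V‖ ≤ a)
    (hb : ‖(1 / (Fintype.card α : ℂ)) • ∑ x, (U x - V)‖ ≤ b) (Y : Matrix n n ℂ) :
    traceNorm ((channel V - (1 / (Fintype.card α : ℂ)) • ∑ x, channel (U x)) Y) ≤
      (a ^ 2 + 2 * b) * traceNorm Y := by
  have hc' : (Fintype.card α : ℂ) ≠ 0 := by exact_mod_cast Fintype.card_ne_zero
  set c : ℂ := 1 / (Fintype.card α : ℂ) with hcdef
  set D : Matrix n n ℂ := c • ∑ x, (U x - V) with hD
  have hexp : (channel V - c • ∑ x, channel (U x)) Y =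
      (-1 : ℂ) • (D * Y * Vᴴ + V * Y * Dᴴ + c • ∑ x, (U x - V) * Y * (U x - V)ᴴ) := by
    have h1 : ∀ x, channel (U x) Y =
        V * Y * Vᴴ + (U x - V) * Y * Vᴴ + V * Y * (U x - V)ᴴ + (U x - V) * Y * (U x - V)ᴴ := by
      intro x
      rw [channel_apply, Matrix.conjTranspose_sub]
      noncomm_ring
    have h2 : D * Y * Vᴴ = c • ∑ x, (U x - V) * Y * Vᴴ := by
      rw [hD, smul_mul_assoc, smul_mul_assoc, Finset.sum_mul, Finset.sum_mul]
    have h3 : V * Y * Dᴴ = c • ∑ x, V * Y * (U x - V)ᴴ := by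
      have : star c = c := by simp [hcdef]
      rw [hD, Matrix.conjTranspose_smul, this, mul_smul_comm, Matrix.conjTranspose_sum,
        Finset.mul_sum]
    rw [h2, h3]
    simp only [LinearMap.sub_apply, LinearMap.smul_apply, LinearMap.sum_apply, h1,
      Finset.sum_add_distrib, smul_add, channel_apply, Finset.sum_const, Finset.card_univ]
    rw [← Nat.cast_smul_eq_nsmul ℂ, smul_smul, hcdef, one_div_mul_cancel hc', one_smul]
    module
  rw [hexp]
  have hVs : ‖Vᴴ‖ ≤ 1 := by rwa [Matrix.l2_opNorm_conjTranspose]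
  have hY := traceNorm_nonneg Y
  have t1 : traceNorm (D * Y * Vᴴ) ≤ b * traceNorm Y := by
    refine (traceNorm_mul_mul_le _ _ _).trans (mul_le_mul_of_nonneg_right ?_ hY)
    exact (mul_le_of_le_one_right (norm_nonneg _) hVs).trans hb
  have t2 : traceNorm (V * Y * Dᴴ) ≤ b * traceNorm Y := by
    refine (traceNorm_mul_mul_le _ _ _).trans (mul_le_mul_of_nonneg_right ?_ hY)
    rw [Matrix.l2_opNorm_conjTranspose]
    exact (mul_le_of_le_one_left (norm_nonneg _) hV).trans hb
  have t3 : traceNorm (c • ∑ x, (U x - V) * Y * (U x - V)ᴴ) ≤ a ^ 2 * traceNorm Y := by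
    have h : traceNorm (∑ x, (U x - V) * Y * (U x - V)ᴴ) ≤
        Fintype.card α * (a ^ 2 * traceNorm Y) := by
      refine (traceNorm_sum_le _ _).trans ?_
      refine (Finset.sum_le_card_nsmul _ _ (a ^ 2 * traceNorm Y) fun x _ => ?_).trans (by simp)
      refine (traceNorm_mul_mul_le _ _ _).trans (mul_le_mul_of_nonneg_right ?_ hY)
      rw [Matrix.l2_opNorm_conjTranspose, ← sq]
      exact pow_le_pow_left₀ (norm_nonneg _) (ha x) 2
    refine (traceNorm_smul_le _ _).trans
      ((mul_le_mul_of_nonneg_left h (norm_nonneg _)).trans (le_of_eq ?_))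
    simp [hcdef]
  have t4 := traceNorm_smul_le (-1 : ℂ)
    (D * Y * Vᴴ + V * Y * Dᴴ + c • ∑ x, (U x - V) * Y * (U x - V)ᴴ)
  rw [norm_neg, norm_one, one_mul] at t4
  refine t4.trans ((traceNorm_add_le _ _).trans ?_)
  linarith [traceNorm_add_le (D * Y * Vᴴ) (V * Y * Dᴴ)]

/-- Errors of contractive maps add up at most linearly under iteration. -/
theorem traceNorm_pow_sub_pow_le (E F : Module.End ℂ (Matrix n n ℂ)) {C : ℝ} (hC : 0 ≤ C)
    (hE : ∀ Y, traceNorm (E Y) ≤ traceNorm Y) (hF : ∀ Y, traceNorm (F Y) ≤ traceNorm Y)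
    (hEF : ∀ Y, traceNorm ((E - F) Y) ≤ C * traceNorm Y) (r : ℕ) (Y : Matrix n n ℂ) :
    traceNorm ((E ^ r - F ^ r) Y) ≤ r * C * traceNorm Y := by
  have hFr : ∀ (r : ℕ) Y, traceNorm ((F ^ r) Y) ≤ traceNorm Y := by
    intro r
    induction r with
    | zero => intro Y; simp
    | succ r ih => intro Y; rw [pow_succ', Module.End.mul_apply]; exact (hF _).trans (ih Y)
  induction r with
  | zero => simp
  | succ r ih =>
    have h : E ^ (r + 1) - F ^ (r + 1) = E * (E ^ r - F ^ r) + (E - F) * F ^ r := by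
      rw [pow_succ', pow_succ', mul_sub, sub_mul]; abel
    rw [h, LinearMap.add_apply, Module.End.mul_apply, Module.End.mul_apply]
    refine (traceNorm_add_le _ _).trans ?_
    have h1 := (hE ((E ^ r - F ^ r) Y)).trans ih
    have h2 := (hEF ((F ^ r) Y)).trans (mul_le_mul_of_nonneg_left (hFr r Y) hC)
    push_cast
    linarith

theorem diamondNorm_le (E : Module.End ℂ (Matrix n n ℂ)) {C : ℝ} (hC : 0 ≤ C)
    (h : ∀ Y, traceNorm (tensorId E Y) ≤ C * traceNorm Y) : diamondNorm E ≤ C := by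
  refine csSup_le ⟨_, 0, by simp, rfl⟩ ?_
  rintro x ⟨Y, hY, rfl⟩
  exact (h Y).trans (mul_le_of_le_one_right hC hY)

/-- The mixing lemma in diamond norm, for `r` repetitions of the averaged channel. -/
theorem diamondNorm_channel_pow_sub_average_pow_le {α : Type*} [Fintype α] [Nonempty α]
    (U : α → Matrix n n ℂ) (V : Matrix n n ℂ) (hU : ∀ x, ‖U x‖ ≤ 1) (hV : ‖V‖ ≤ 1) {a b : ℝ}
    (ha : ∀ x, ‖U x - V‖ ≤ a)
    (hb : ‖(1 / (Fintype.card α : ℂ)) • ∑ x, (U x - V)‖ ≤ b) (r : ℕ) :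
    diamondNorm (channel V ^ r - ((1 / (Fintype.card α : ℂ)) • ∑ x, channel (U x)) ^ r) ≤
      r * (a ^ 2 + 2 * b) := by
  have hC : 0 ≤ a ^ 2 + 2 * b := by
    have := (norm_nonneg _).trans hb
    positivity
  refine diamondNorm_le _ (by positivity) fun Y => ?_
  simp only [tensorId_sub, tensorId_pow, tensorId_smul, tensorId_sum, tensorId_channel]
  have hle : ∀ A : Matrix n n ℂ, ‖A ⊗ₖ (1 : Matrix n n ℂ)‖ ≤ ‖A‖ := norm_kroneckerOne_le
  have hsub : ∀ x, U x ⊗ₖ (1 : Matrix n n ℂ) - V ⊗ₖ (1 : Matrix n n ℂ) =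
      kroneckerOne (U x - V) := fun x => (map_sub kroneckerOne _ _).symm
  refine traceNorm_pow_sub_pow_le _ _ hC (traceNorm_channel_le ((hle V).trans hV))
    (traceNorm_average_channel_le _ fun x => (hle _).trans (hU x))
    (traceNorm_channel_sub_average_le _ _ ((hle V).trans hV) (fun x => ?_) ?_) r Y
  · rw [hsub]
    exact (norm_kroneckerOne_le _).trans (ha x)
  · simp only [hsub]
    rw [← map_sum, ← map_smul]
    exact (norm_kroneckerOne_le _).trans hb

end TraceNorm

/-! ### Formal exponential series over a noncommutative algebra -/

section FormalSeries

open PowerSeries Finset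

variable {A : Type*} [Ring A] [Algebra ℝ A] {B : Type*} [Ring B] [Algebra ℝ B]

/-- The formal exponential `∑ aˢ Xˢ / s!` of an element `a` of a real algebra. -/
def formalExp (a : A) : A⟦X⟧ := PowerSeries.mk fun s => ((s ! : ℝ)⁻¹) • a ^ s

@[simp] theorem coeff_formalExp (a : A) (s : ℕ) :
    coeff s (formalExp a) = ((s ! : ℝ)⁻¹) • a ^ s := coeff_mk _ _

theorem formalExp_mul {a b : A} (h : Commute a b) :
    formalExp a * formalExp b = formalExp (a + b) := by
  ext s
  rw [coeff_mul, coeff_formalExp, h.add_pow', Finset.smul_sum]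
  refine Finset.sum_congr rfl fun p hp => ?_
  rw [HasAntidiagonal.mem_antidiagonal] at hp
  subst hp
  rw [coeff_formalExp, coeff_formalExp, smul_mul_smul_comm, ← Nat.cast_smul_eq_nsmul ℝ, smul_smul]
  congr 1
  have h1 : ((p.1 + p.2).choose p.1 : ℝ) * (p.1 ! : ℝ) * (p.2 ! : ℝ) = ((p.1 + p.2)! : ℝ) := by
    rw [Nat.choose_symm_add]
    exact_mod_cast Nat.add_choose_mul_factorial_mul_factorial p.1 p.2
  have h2 := Nat.factorial_ne_zero p.1
  have h3 := Nat.factorial_ne_zero p.2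
  have h4 := Nat.factorial_ne_zero (p.1 + p.2)
  field_simp
  linarith

theorem formalExp_mul_comm {C : Type*} [CommRing C] [Algebra ℝ C] (a b : C) :
    formalExp a * formalExp b = formalExp (a + b) :=
  formalExp_mul (mul_comm a b)

@[simp] theorem formalExp_zero : formalExp (0 : A) = 1 := by
  ext s
  rw [coeff_formalExp, coeff_one]
  split_ifs with h
  · simp [h]
  · simp [zero_pow h]

/-- The substitution `X ↦ c X`, for `c` real. Mathlib's `PowerSeries.rescale` asks for commutative
coefficients. -/
def dilate (c : ℝ) : A⟦X⟧ →+* A⟦X⟧ where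
  toFun P := PowerSeries.mk fun s => c ^ s • coeff s P
  map_one' := by
    ext s
    rw [coeff_mk, coeff_one]
    split_ifs with h
    · simp [h]
    · simp
  map_mul' P Q := by
    ext s
    rw [coeff_mk, coeff_mul, coeff_mul, Finset.smul_sum]
    refine Finset.sum_congr rfl fun p hp => ?_
    rw [HasAntidiagonal.mem_antidiagonal] at hp
    rw [coeff_mk, coeff_mk, smul_mul_smul_comm, ← pow_add, hp]
  map_zero' := by ext s; simp
  map_add' P Q := by ext s; simp

@[simp] theorem coeff_dilate (c : ℝ) (P : A⟦X⟧) (s : ℕ) :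
    coeff s (dilate c P) = c ^ s • coeff s P :=
  coeff_mk s fun i => c ^ i • coeff i P

theorem dilate_formalExp (c : ℝ) (a : A) : dilate c (formalExp a) = formalExp (c • a) := by
  ext s
  rw [coeff_dilate, coeff_formalExp, coeff_formalExp, smul_pow, smul_comm]

theorem dilate_dilate_comm (c d : ℝ) (P : A⟦X⟧) :
    dilate c (dilate d P) = dilate d (dilate c P) := by
  ext s
  simp only [coeff_dilate]
  rw [smul_comm]

theorem map_formalExp (f : A →ₐ[ℝ] B) (a : A) :
    PowerSeries.map (f : A →+* B) (formalExp a) = formalExp (f a) := by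
  ext s
  simp

theorem map_dilate (f : A →ₐ[ℝ] B) (c : ℝ) (P : A⟦X⟧) :
    PowerSeries.map (f : A →+* B) (dilate c P) = dilate c (PowerSeries.map (f : A →+* B) P) := by
  ext s
  simp

/-! ### The formal Suzuki product -/

variable {L : ℕ}

/-- The second-order formula, as a formal power series in `z` over any real algebra in which
the summands `x j` live. -/
def formalSuzukiTwo (x : Fin L → A) : A⟦X⟧ :=
  ((List.finRange L).map fun j => formalExp ((1 / 2 : ℝ) • x j)).prod *
    (((List.finRange L).map fun j => formalExp ((1 / 2 : ℝ) • x j)).reverse).prod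

/-- The `(2k)`th-order formula, as a formal power series in `z` over any real algebra in which
the summands `x j` live. The value at `k = 0` is a placeholder, as in `suzuki`. -/
def formalSuzuki (x : Fin L → A) : ℕ → A⟦X⟧
  | 0 => 1
  | 1 => formalSuzukiTwo x
  | k + 2 =>
      dilate (suzukiCoeff (k + 2)) (formalSuzuki x (k + 1)) ^ 2 *
        dilate (1 - 4 * suzukiCoeff (k + 2)) (formalSuzuki x (k + 1)) *
        dilate (suzukiCoeff (k + 2)) (formalSuzuki x (k + 1)) ^ 2

theorem formalSuzuki_succ_succ (x : Fin L → A) (k : ℕ) :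
    formalSuzuki x (k + 2) = dilate (suzukiCoeff (k + 2)) (formalSuzuki x (k + 1)) ^ 2 *
        dilate (1 - 4 * suzukiCoeff (k + 2)) (formalSuzuki x (k + 1)) *
        dilate (suzukiCoeff (k + 2)) (formalSuzuki x (k + 1)) ^ 2 := rfl

theorem map_formalSuzukiTwo (f : A →ₐ[ℝ] B) (x : Fin L → A) :
    PowerSeries.map (f : A →+* B) (formalSuzukiTwo x) = formalSuzukiTwo (f ∘ x) := by
  simp only [formalSuzukiTwo, map_mul, map_list_prod, List.map_map, ← List.map_reverse]
  congr 3 <;>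
  · funext j
    rw [Function.comp_apply, map_formalExp, map_smul]
    rfl

/-- The formal product formula is natural in the algebra. -/
theorem map_formalSuzuki (f : A →ₐ[ℝ] B) (x : Fin L → A) (k : ℕ) :
    PowerSeries.map (f : A →+* B) (formalSuzuki x k) = formalSuzuki (f ∘ x) k := by
  induction k using Nat.twoStepInduction with
  | zero => exact map_one _
  | one => exact map_formalSuzukiTwo f x
  | more k _ ih =>
    simp only [formalSuzuki_succ_succ, map_mul, map_pow, map_dilate, ih]

theorem prod_map_formalExp {C : Type*} [CommRing C] [Algebra ℝ C] (l : List (Fin L))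
    (x : Fin L → C) :
    (l.map fun j => formalExp (x j)).prod = formalExp (l.map x).sum := by
  induction l with
  | nil => simp
  | cons j l ih => simp [ih, formalExp_mul_comm]

theorem formalSuzukiTwo_comm {C : Type*} [CommRing C] [Algebra ℝ C] (x : Fin L → C) :
    formalSuzukiTwo x = formalExp (∑ j, x j) := by
  rw [formalSuzukiTwo, List.prod_reverse, prod_map_formalExp, formalExp_mul_comm]
  congr 1
  rw [← List.ofFn_eq_map, List.sum_ofFn, ← Finset.smul_sum, ← add_smul]
  norm_num

/-- Commuting exponentials can be merged: in a commutative algebra all product formulas are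
exact. -/
theorem formalSuzuki_comm {C : Type*} [CommRing C] [Algebra ℝ C] (x : Fin L → C) (k : ℕ) :
    formalSuzuki x (k + 1) = formalExp (∑ j, x j) := by
  induction k with
  | zero => exact formalSuzukiTwo_comm x
  | succ k ih =>
    simp only [formalSuzuki_succ_succ, ih, dilate_formalExp, sq, formalExp_mul_comm]
    congr 1
    module

theorem prod_formalExp_mul_prod_reverse_neg (l : List (Fin L)) (x : Fin L → A) :
    (l.map fun j => formalExp (x j)).prod *
      (l.map fun j => formalExp (-x j)).reverse.prod = 1 := by
  induction l with
  | nil => simp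
  | cons j l ih =>
    simp only [List.map_cons, List.prod_cons, List.reverse_cons, List.prod_append, List.prod_nil,
      mul_one]
    rw [mul_assoc, ← mul_assoc (List.prod _), ih, one_mul, formalExp_mul (Commute.neg_right rfl)]
    simp

/-- The product formulas are symmetric: `S(z) S(-z) = 1`. -/
theorem formalSuzuki_mul_dilate_neg_one (x : Fin L → A) (k : ℕ) :
    formalSuzuki x k * dilate (-1) (formalSuzuki x k) = 1 := by
  induction k using Nat.twoStepInduction with
  | zero => simp [formalSuzuki]
  | one =>
    have h1 := prod_formalExp_mul_prod_reverse_neg (List.finRange L)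
      fun j => (1 / 2 : ℝ) • x j
    have h2 := prod_formalExp_mul_prod_reverse_neg (List.finRange L).reverse
      fun j => (1 / 2 : ℝ) • x j
    simp only [← List.map_reverse, List.reverse_reverse] at h1 h2
    simp only [formalSuzuki, formalSuzukiTwo, map_mul, map_list_prod, List.map_map,
      ← List.map_reverse, Function.comp_def, dilate_formalExp, neg_smul, one_smul]
    rw [mul_assoc, ← mul_assoc (List.prod (List.map _ (List.finRange L).reverse)), h2, one_mul, h1]
  | more k _ ih =>
    have h : ∀ c : ℝ, dilate c (formalSuzuki x (k + 1)) *
        dilate (-1) (dilate c (formalSuzuki x (k + 1))) = 1 := fun c => by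
      rw [dilate_dilate_comm, ← map_mul, ih, map_one]
    have hp := h (suzukiCoeff (k + 2))
    have hq := h (1 - 4 * suzukiCoeff (k + 2))
    simp only [formalSuzuki_succ_succ, map_mul, map_pow]
    set P := dilate (suzukiCoeff (k + 2)) (formalSuzuki x (k + 1))
    set Q := dilate (1 - 4 * suzukiCoeff (k + 2)) (formalSuzuki x (k + 1))
    set P' := dilate (-1) P
    set Q' := dilate (-1) Q
    calc P ^ 2 * Q * P ^ 2 * (P' ^ 2 * Q' * P' ^ 2)
        = P * (P * (Q * (P * (P * P') * P') * Q') * P') * P' := by noncomm_ring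
      _ = 1 := by simp [hp, hq]

/-! ### Order conditions -/

/-- `P` and `Q` have constant term `1`, agree up to order `m - 1`, and `P = Q + d Xᵐ + ⋯`. -/
structure LeadingError (m : ℕ) (P Q : A⟦X⟧) (d : A) : Prop where
  left_zero : coeff 0 P = 1
  right_zero : coeff 0 Q = 1
  agree : ∀ s < m, coeff s P = coeff s Q
  leading : coeff m P = coeff m Q + d

namespace LeadingError

variable {A : Type*} [Ring A] {m : ℕ} {P Q P' Q' : A⟦X⟧} {d d' : A}

/-- To first order, errors add under multiplication. -/
protected theorem mul (hm : 0 < m) (h : LeadingError m P Q d) (h' : LeadingError m P' Q' d') :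
    LeadingError m (P * P') (Q * Q') (d + d') where
  left_zero := by simp [coeff_mul, h.left_zero, h'.left_zero]
  right_zero := by simp [coeff_mul, h.right_zero, h'.right_zero]
  agree s hs := by
    rw [coeff_mul, coeff_mul]
    refine Finset.sum_congr rfl fun p hp => ?_
    rw [HasAntidiagonal.mem_antidiagonal] at hp
    rw [h.agree p.1 (by omega), h'.agree p.2 (by omega)]
  leading := by
    have key : ∀ R R' : A⟦X⟧, coeff 0 R = 1 → coeff 0 R' = 1 → coeff m (R * R') =
        coeff m R + coeff m R' +
          ∑ p ∈ ((antidiagonal m).erase (m, 0)).erase (0, m), coeff p.1 R * coeff p.2 R' := by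
      intro R R' hR hR'
      rw [coeff_mul, ← Finset.add_sum_erase _ _ (a := (m, 0)) (by simp),
        ← Finset.add_sum_erase _ _ (a := (0, m)) (by simp; omega)]
      simp [hR, hR', add_assoc]
    rw [key _ _ h.left_zero h'.left_zero, key _ _ h.right_zero h'.right_zero, h.leading,
      h'.leading]
    have : ∑ p ∈ ((antidiagonal m).erase (m, 0)).erase (0, m), coeff p.1 P * coeff p.2 P' =
        ∑ p ∈ ((antidiagonal m).erase (m, 0)).erase (0, m), coeff p.1 Q * coeff p.2 Q' := by
      refine Finset.sum_congr rfl fun ⟨i, j⟩ hp => ?_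
      simp only [mem_erase, HasAntidiagonal.mem_antidiagonal, ne_eq, Prod.mk.injEq] at hp
      rw [h.agree i (by omega), h'.agree j (by omega)]
    rw [this]
    abel

protected theorem dilate [Algebra ℝ A] (h : LeadingError m P Q d) (c : ℝ) :
    LeadingError m (dilate c P) (dilate c Q) (c ^ m • d) where
  left_zero := by simp [h.left_zero]
  right_zero := by simp [h.right_zero]
  agree s hs := by simp [h.agree s hs]
  leading := by simp [h.leading]

theorem eq_zero_of_eq (h : LeadingError m P P d) : d = 0 := by
  simpa using h.leading

/-- If all coefficients up to order `m - 1` agree, some leading error exists. -/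
theorem of_agree (hP : coeff 0 P = 1) (hQ : coeff 0 Q = 1)
    (h : ∀ s < m, coeff s P = coeff s Q) : LeadingError m P Q (coeff m P - coeff m Q) :=
  ⟨hP, hQ, h, by abel⟩

/-- Between symmetric series the leading error cannot be of even order. -/
theorem eq_zero_of_symmetric [Algebra ℝ A] (hm : 0 < m) (he : Even m) (h : LeadingError m P Q d)
    (hP : P * ProductFormula.dilate (-1) P = 1) (hQ : Q * ProductFormula.dilate (-1) Q = 1) :
    d = 0 := by
  have h1 := h.mul hm (h.dilate (-1))
  rw [hP, hQ, he.neg_one_pow, one_smul] at h1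
  have h2 := h1.eq_zero_of_eq
  rw [← two_smul ℝ] at h2
  exact (smul_eq_zero.1 h2).resolve_left two_ne_zero

end LeadingError

theorem suzukiCoeff_bounds (k : ℕ) :
    0 < suzukiCoeff (k + 2) ∧ suzukiCoeff (k + 2) ≤ 1 / 2 := by
  have h1 : (4 : ℝ) ^ (1 / (2 * ((k + 2 : ℕ) : ℝ) - 1)) ≤ 2 := by
    have h2 : (4 : ℝ) ^ (1 / 2 : ℝ) = 2 := by
      rw [← Real.sqrt_eq_rpow, show (4 : ℝ) = 2 ^ 2 by norm_num]
      simp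
    rw [← h2]
    refine Real.rpow_le_rpow_of_exponent_le (by norm_num) ?_
    push_cast
    apply one_div_le_one_div_of_le (by norm_num)
    have : (0 : ℝ) ≤ k := k.cast_nonneg
    linarith
  unfold suzukiCoeff
  constructor
  · apply one_div_pos.2; linarith
  · apply one_div_le_one_div_of_le (by norm_num); linarith

/-- The defining property of the Suzuki coefficient: the leading errors of the five factors
cancel. -/
theorem suzukiCoeff_spec (k : ℕ) :
    4 * suzukiCoeff (k + 2) ^ (2 * k + 3) + (1 - 4 * suzukiCoeff (k + 2)) ^ (2 * k + 3) = 0 := by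
  obtain ⟨h0, h1⟩ := suzukiCoeff_bounds k
  set p := suzukiCoeff (k + 2) with hp
  set q := (4 : ℝ) ^ (1 / (2 * ((k + 2 : ℕ) : ℝ) - 1)) with hq
  have hpq : p = 1 / (4 - q) := rfl
  have hne : 4 - q ≠ 0 := by
    intro h
    rw [hpq, h] at h0
    simp at h0
  have h2 : q * p = 4 * p - 1 := by
    rw [hpq]
    field_simp
    ring
  have h3 : q ^ (2 * k + 3) = 4 := by
    rw [hq, ← Real.rpow_natCast, ← Real.rpow_mul (by norm_num)]
    have : 1 / (2 * ((k + 2 : ℕ) : ℝ) - 1) * ((2 * k + 3 : ℕ) : ℝ) = 1 := by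
      have : (0 : ℝ) ≤ k := k.cast_nonneg
      push_cast
      rw [one_div_mul_eq_div, div_eq_one_iff_eq] <;> linarith
    rw [this, Real.rpow_one]
  have hodd : Odd (2 * k + 3) := ⟨k + 1, by ring⟩
  rw [show (1 : ℝ) - 4 * p = -(4 * p - 1) by ring, hodd.neg_pow, ← h2, mul_pow, h3]
  ring

theorem formalExp_mul_dilate_neg_one (a : A) : formalExp a * dilate (-1) (formalExp a) = 1 := by
  rw [dilate_formalExp, formalExp_mul ((Commute.refl a).smul_right _)]
  simp

theorem leadingError_prod_formalExp (l : List (Fin L)) (x : Fin L → A) :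
    LeadingError 1 (l.map fun j => formalExp (x j)).prod 1 (l.map x).sum := by
  induction l with
  | nil => exact ⟨by simp, by simp, fun s _ => rfl, by simp⟩
  | cons j l ih =>
    have h : LeadingError 1 (formalExp (x j)) 1 (x j) :=
      ⟨by simp, by simp, fun s hs => by simp [Nat.lt_one_iff.1 hs], by simp [coeff_one]⟩
    simpa using h.mul one_pos ih

theorem leadingError_formalSuzukiTwo (x : Fin L → A) :
    LeadingError 1 (formalSuzukiTwo x) (formalExp (∑ j, x j)) 0 := by
  have h1 := leadingError_prod_formalExp (List.finRange L) fun j => (1 / 2 : ℝ) • x j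
  have h2 := leadingError_prod_formalExp (List.finRange L).reverse fun j => (1 / 2 : ℝ) • x j
  have h3 := h1.mul one_pos h2
  rw [List.map_reverse, List.map_reverse, List.sum_reverse, mul_one] at h3
  refine ⟨h3.left_zero, by simp, fun s hs => ?_, ?_⟩
  · rw [Nat.lt_one_iff.1 hs]
    exact h3.left_zero.trans (by simp)
  · refine h3.leading.trans ?_
    rw [← List.ofFn_eq_map, List.sum_ofFn, ← Finset.smul_sum, ← add_smul]
    norm_num [coeff_one]

/-- The formula `S_{2k}` is correct to order `2k`. Suzuki's choice of coefficients removes the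
error of order `2k - 1` of the previous formula, and symmetry that of order `2k`. -/
theorem coeff_formalSuzuki_eq (x : Fin L → A) (k : ℕ) :
    ∀ s < 2 * k + 3, coeff s (formalSuzuki x (k + 1)) = coeff s (formalExp (∑ j, x j)) := by
  have key : ∀ (m : ℕ) (_ : Even (m + 1)) (P : A⟦X⟧), P * dilate (-1) P = 1 →
      LeadingError m P (formalExp (∑ j, x j)) 0 →
      ∀ s < m + 2, coeff s P = coeff s (formalExp (∑ j, x j)) := by
    intro m he P hP h
    have h1 : ∀ s < m + 1, coeff s P = coeff s (formalExp (∑ j, x j)) := by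
      intro s hs
      rcases Nat.lt_succ_iff_lt_or_eq.1 hs with hs | rfl
      · exact h.agree s hs
      · simpa using h.leading
    have h2 := LeadingError.of_agree h.left_zero h.right_zero h1
    have h3 := h2.eq_zero_of_symmetric m.succ_pos he hP (formalExp_mul_dilate_neg_one _)
    intro s hs
    rcases Nat.lt_succ_iff_lt_or_eq.1 hs with hs | rfl
    · exact h1 s hs
    · exact sub_eq_zero.1 h3
  induction k with
  | zero =>
    exact key 1 (by decide) _ (formalSuzuki_mul_dilate_neg_one x 1) (leadingError_formalSuzukiTwo x)
  | succ k ih =>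
    refine key (2 * k + 3) ⟨k + 2, by ring⟩ _ (formalSuzuki_mul_dilate_neg_one x (k + 2)) ?_
    have hS := LeadingError.of_agree (m := 2 * k + 3)
      ((ih 0 (by omega)).trans (by simp)) (by simp) ih
    set d := coeff (2 * k + 3) (formalSuzuki x (k + 1)) -
      coeff (2 * k + 3) (formalExp (∑ j, x j))
    set p := suzukiCoeff (k + 2) with hp
    have hm : 0 < 2 * k + 3 := by omega
    have h1 := hS.dilate p
    have h2 := hS.dilate (1 - 4 * p)
    have h3 := ((h1.mul hm h1).mul hm h2).mul hm (h1.mul hm h1)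
    convert! h3 using 1
    · rw [formalSuzuki_succ_succ, sq]
    · simp only [dilate_formalExp]
      rw [formalExp_mul, formalExp_mul, formalExp_mul]
      · congr 1
        module
      all_goals
        first
        | exact ((Commute.refl _).smul_left _).smul_right _
        | simp only [← add_smul]; exact ((Commute.refl _).smul_left _).smul_right _
    · have := suzukiCoeff_spec k
      rw [← hp] at this
      have h4 : p ^ (2 * k + 3) • d + p ^ (2 * k + 3) • d + (1 - 4 * p) ^ (2 * k + 3) • d +
          (p ^ (2 * k + 3) • d + p ^ (2 * k + 3) • d) =
          (4 * p ^ (2 * k + 3) + (1 - 4 * p) ^ (2 * k + 3)) • d := by module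
      rw [h4, this, zero_smul]

end FormalSeries

section Words

open PowerSeries Finset

/-! ### Linear functionals on monoid algebras -/

section Pairing

variable {M N E : Type*} [AddCommGroup E] [Module ℝ E]

/-- The linear extension `∑ c(w) w ↦ ∑ c(w) f(w)` of a function `f` on a monoid to its monoid
algebra. -/
def pairing (f : M → E) : MonoidAlgebra ℝ M →ₗ[ℝ] E :=
  Finsupp.linearCombination ℝ f ∘ₗ (MonoidAlgebra.coeffLinearEquiv ℝ).toLinearMap

theorem pairing_apply (f : M → E) (c : MonoidAlgebra ℝ M) :
    pairing f c = c.coeff.sum fun w r => r • f w := rfl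

@[simp] theorem pairing_of [Monoid M] (f : M → E) (w : M) :
    pairing f (MonoidAlgebra.of ℝ M w) = f w := by
  simp [pairing_apply]

theorem pairing_monoidHom [Monoid M] {A : Type*} [Ring A] [Algebra ℝ A] (F : M →* A)
    (c : MonoidAlgebra ℝ M) :
    pairing F c = MonoidAlgebra.lift ℝ A M F c := by
  rw [pairing_apply, MonoidAlgebra.lift_apply]

theorem pairing_add_left (f g : M → E) (c : MonoidAlgebra ℝ M) :
    pairing (fun w => f w + g w) c = pairing f c + pairing g c := by
  simp only [pairing_apply, smul_add]
  exact Finsupp.sum_add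

theorem pairing_smul_sum_left {α : Type*} (r : ℝ) (s : Finset α) (f : α → M → E)
    (c : MonoidAlgebra ℝ M) :
    pairing (fun w => r • ∑ a ∈ s, f a w) c = r • ∑ a ∈ s, pairing (f a) c := by
  simp only [pairing_apply, Finsupp.sum, Finset.smul_sum]
  rw [Finset.sum_comm]
  refine Finset.sum_congr rfl fun w _ => Finset.sum_congr rfl fun a _ => smul_comm _ _ _

theorem pairing_mapDomain [Monoid M] [Monoid N] (p : M →* N) (f : N → E) (c : MonoidAlgebra ℝ M) :
    pairing f (MonoidAlgebra.mapDomainAlgHom ℝ ℝ p c) = pairing (fun w => f (p w)) c := by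
  change ((MonoidAlgebra.mapDomain p c).coeff).sum _ = _
  rw [MonoidAlgebra.mapDomain, Finsupp.sum_mapDomain_index (by simp) (by simp [add_smul])]
  rfl

/-- Coefficientwise domination `|c(w)| ≤ C(w)` in a monoid algebra. -/
def Dominated (c C : MonoidAlgebra ℝ M) : Prop := ∀ w, |c.coeff w| ≤ C.coeff w

theorem coeff_mul_nonneg [Monoid M] {a b : MonoidAlgebra ℝ M} (ha : ∀ w, 0 ≤ a.coeff w)
    (hb : ∀ w, 0 ≤ b.coeff w) (w : M) : 0 ≤ (a * b).coeff w := by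
  classical
  rw [MonoidAlgebra.mul_def]
  simp only [Finsupp.sum, MonoidAlgebra.coeff_sum, Finsupp.finsetSum_apply]
  refine Finset.sum_nonneg fun u _ => Finset.sum_nonneg fun v _ => ?_
  rw [MonoidAlgebra.coeff_single, Finsupp.single_apply]
  split_ifs
  · exact mul_nonneg (ha u) (hb v)
  · exact le_rfl

namespace Dominated

variable {c C d D : MonoidAlgebra ℝ M}

theorem of_nonneg (h : ∀ w, 0 ≤ c.coeff w) : Dominated c c := fun w => (abs_of_nonneg (h w)).le

theorem of [Monoid M] (w : M) : Dominated (MonoidAlgebra.of ℝ M w) (MonoidAlgebra.of ℝ M w) := by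
  classical
  refine of_nonneg fun v => ?_
  rw [MonoidAlgebra.of_apply, MonoidAlgebra.coeff_single, Finsupp.single_apply]
  split_ifs <;> norm_num

theorem one [Monoid M] : Dominated (1 : MonoidAlgebra ℝ M) 1 := of 1

theorem zero : Dominated (0 : MonoidAlgebra ℝ M) 0 := fun w => by simp

protected theorem add (h : Dominated c C) (h' : Dominated d D) : Dominated (c + d) (C + D) := by
  intro w
  simp only [MonoidAlgebra.coeff_add, Finsupp.add_apply]
  exact (abs_add_le _ _).trans (add_le_add (h w) (h' w))

protected theorem sub (h : Dominated c C) (h' : Dominated d D) : Dominated (c - d) (C + D) := by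
  intro w
  simp only [MonoidAlgebra.coeff_add, MonoidAlgebra.coeff_sub, Finsupp.add_apply,
    Finsupp.sub_apply]
  exact (abs_sub _ _).trans (add_le_add (h w) (h' w))

protected theorem smul (h : Dominated c C) {r : ℝ} (hr : |r| ≤ 1) : Dominated (r • c) C := by
  intro w
  rw [MonoidAlgebra.coeff_smul_apply, smul_eq_mul, abs_mul]
  exact (mul_le_of_le_one_left (abs_nonneg _) hr).trans (h w)

theorem smul_smul (h : Dominated c C) {r : ℝ} (hr : 0 ≤ r) : Dominated (r • c) (r • C) := by
  intro w
  rw [MonoidAlgebra.coeff_smul_apply, MonoidAlgebra.coeff_smul_apply, smul_eq_mul, smul_eq_mul,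
    abs_mul, abs_of_nonneg hr]
  exact mul_le_mul_of_nonneg_left (h w) hr

protected theorem mul [Monoid M] (h : Dominated c C) (h' : Dominated d D) :
    Dominated (c * d) (C * D) := by
  have h1 : ∀ w, 0 ≤ (C - c).coeff w := fun w => by
    simpa using (abs_le.1 (h w)).2
  have h2 : ∀ w, 0 ≤ (C + c).coeff w := fun w => by
    have := (abs_le.1 (h w)).1
    simp only [MonoidAlgebra.coeff_add, Finsupp.add_apply]; linarith
  have h3 : ∀ w, 0 ≤ (D - d).coeff w := fun w => by
    simpa using (abs_le.1 (h' w)).2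
  have h4 : ∀ w, 0 ≤ (D + d).coeff w := fun w => by
    have := (abs_le.1 (h' w)).1
    simp only [MonoidAlgebra.coeff_add, Finsupp.add_apply]; linarith
  -- `2 (C D ∓ c d)` is a sum of two products of nonnegative elements
  have e1 : (2 : ℝ) • (C * D - c * d) = (C - c) * (D + d) + (C + c) * (D - d) := by
    rw [two_smul]; noncomm_ring
  have e2 : (2 : ℝ) • (C * D + c * d) = (C - c) * (D - d) + (C + c) * (D + d) := by
    rw [two_smul]; noncomm_ring
  intro w
  have f1 := congrArg (fun a => MonoidAlgebra.coeff a w) e1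
  have f2 := congrArg (fun a => MonoidAlgebra.coeff a w) e2
  simp only [MonoidAlgebra.coeff_add, MonoidAlgebra.coeff_smul_apply, Finsupp.add_apply,
    MonoidAlgebra.coeff_sub, Finsupp.sub_apply, smul_eq_mul] at f1 f2
  have g1 := coeff_mul_nonneg h1 h4 w
  have g2 := coeff_mul_nonneg h2 h3 w
  have g3 := coeff_mul_nonneg h1 h3 w
  have g4 := coeff_mul_nonneg h2 h4 w
  rw [abs_le]
  constructor <;> linarith

theorem sum {α : Type*} (s : Finset α) (f F : α → MonoidAlgebra ℝ M)
    (h : ∀ a ∈ s, Dominated (f a) (F a)) : Dominated (∑ a ∈ s, f a) (∑ a ∈ s, F a) := by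
  classical
  induction s using Finset.induction_on with
  | empty => simpa using zero
  | insert a s ha ih =>
    rw [Finset.sum_insert ha, Finset.sum_insert ha]
    exact (h a (by simp)).add (ih fun b hb => h b (by simp [hb]))

protected theorem pow [Monoid M] (h : Dominated c C) (s : ℕ) : Dominated (c ^ s) (C ^ s) := by
  induction s with
  | zero => simpa using one
  | succ s ih => rw [pow_succ, pow_succ]; exact ih.mul h

theorem norm_pairing_le {E : Type*} [NormedAddCommGroup E] [NormedSpace ℝ E]
    (h : Dominated c C) {F : M → E} {f : M → ℝ} (hF : ∀ w, ‖F w‖ ≤ f w) :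
    ‖pairing F c‖ ≤ pairing f C := by
  have hf : ∀ w, 0 ≤ f w := fun w => (norm_nonneg _).trans (hF w)
  have hC : ∀ w, 0 ≤ C.coeff w := fun w => (abs_nonneg _).trans (h w)
  rw [pairing_apply, pairing_apply, Finsupp.sum, Finsupp.sum]
  have h1 : ‖∑ w ∈ c.coeff.support, c.coeff w • F w‖ ≤ ∑ w ∈ c.coeff.support, C.coeff w • f w := by
    refine norm_sum_le_of_le _ fun w _ => ?_
    rw [norm_smul, smul_eq_mul]
    exact mul_le_mul (h w) (hF w) (norm_nonneg _) (hC w)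
  refine h1.trans (Finset.sum_le_sum_of_subset_of_nonneg (fun w hw => ?_) fun w _ _ =>
    mul_nonneg (hC w) (hf w))
  rw [Finsupp.mem_support_iff] at hw ⊢
  intro h0
  have := h w
  rw [h0] at this
  exact hw (abs_nonpos_iff.1 this)

end Dominated

variable [Monoid M]

/-- Domination of formal power series over a monoid algebra, coefficient by coefficient. -/
def SeriesDominated (P Q : (MonoidAlgebra ℝ M)⟦X⟧) : Prop := ∀ s, Dominated (coeff s P) (coeff s Q)

namespace SeriesDominated

variable {P Q P' Q' : (MonoidAlgebra ℝ M)⟦X⟧}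

theorem one : SeriesDominated (1 : (MonoidAlgebra ℝ M)⟦X⟧) 1 := by
  intro s
  rw [coeff_one]
  split_ifs
  · exact Dominated.one
  · exact Dominated.zero

protected theorem mul (h : SeriesDominated P Q) (h' : SeriesDominated P' Q') :
    SeriesDominated (P * P') (Q * Q') := by
  intro s
  rw [coeff_mul, coeff_mul]
  exact Dominated.sum _ _ _ fun p _ => (h p.1).mul (h' p.2)

protected theorem pow (h : SeriesDominated P Q) (m : ℕ) : SeriesDominated (P ^ m) (Q ^ m) := by
  induction m with
  | zero => simpa using one
  | succ m ih => rw [pow_succ, pow_succ]; exact ih.mul h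

theorem list_prod {α : Type*} (l : List α) (f F : α → (MonoidAlgebra ℝ M)⟦X⟧)
    (h : ∀ a, SeriesDominated (f a) (F a)) : SeriesDominated (l.map f).prod (l.map F).prod := by
  induction l with
  | nil => simpa using one
  | cons a l ih => simpa using (h a).mul ih

theorem dilate (h : SeriesDominated P Q) {c : ℝ} (hc : |c| ≤ 1) :
    SeriesDominated (dilate c P) Q := by
  intro s
  rw [coeff_dilate]
  refine (h s).smul ?_
  rw [abs_pow]
  exact pow_le_one₀ (abs_nonneg _) hc

theorem formalExp {c C : MonoidAlgebra ℝ M} (h : Dominated c C) :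
    SeriesDominated (formalExp c) (formalExp C) := by
  intro s
  rw [coeff_formalExp, coeff_formalExp]
  exact (h.pow s).smul_smul (by positivity)

end SeriesDominated

end Pairing

/-! ### The universal product formula over the free algebra -/

variable {L : ℕ}

/-- The generators of the free algebra, realized as the monoid algebra of words. -/
def letter (j : Fin L) : MonoidAlgebra ℝ (FreeMonoid (Fin L)) :=
  MonoidAlgebra.of ℝ _ (FreeMonoid.of j)

/-- Substitution of elements `y j` of an algebra for the letters. -/
def substitute {A : Type*} [Ring A] [Algebra ℝ A] (y : Fin L → A) :
    MonoidAlgebra ℝ (FreeMonoid (Fin L)) →ₐ[ℝ] A :=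
  MonoidAlgebra.lift ℝ A _ (FreeMonoid.lift y)

theorem substitute_comp_letter {A : Type*} [Ring A] [Algebra ℝ A] (y : Fin L → A) :
    substitute y ∘ letter = y := by
  funext j
  simp [substitute, letter]

/-- The free algebra with its letters made to commute. -/
def abelianize : MonoidAlgebra ℝ (FreeMonoid (Fin L)) →ₐ[ℝ]
    MonoidAlgebra ℝ (Multiplicative (Multiset (Fin L))) :=
  MonoidAlgebra.mapDomainAlgHom ℝ ℝ
    (FreeMonoid.lift fun j => Multiplicative.ofAdd ({j} : Multiset (Fin L)))

theorem lift_ofAdd_singleton (w : FreeMonoid (Fin L)) :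
    FreeMonoid.lift (fun j => Multiplicative.ofAdd ({j} : Multiset (Fin L))) w =
      Multiplicative.ofAdd (w.toList : Multiset (Fin L)) := by
  induction w using FreeMonoid.inductionOn' with
  | one => rfl
  | of_mul j w ih =>
    rw [map_mul, ih, FreeMonoid.lift_eval_of, ← ofAdd_add]
    rfl

/-- A functional that is invariant under rearranging words only sees abelianizations. -/
theorem pairing_eq_of_abelianize_eq {E : Type*} [AddCommGroup E] [Module ℝ E]
    {f : FreeMonoid (Fin L) → E} (hf : ∀ v w, v.toList.Perm w.toList → f v = f w)
    {c d : MonoidAlgebra ℝ (FreeMonoid (Fin L))} (h : abelianize c = abelianize d) :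
    pairing f c = pairing f d := by
  let g : Multiplicative (Multiset (Fin L)) → E := fun m => f (FreeMonoid.ofList m.toAdd.toList)
  have hg : ∀ c, pairing f c = pairing g (abelianize c) := by
    intro c
    rw [abelianize, pairing_mapDomain]
    congr 1
    congr 1
    funext w
    refine hf _ _ ?_
    rw [lift_ofAdd_singleton, FreeMonoid.toList_ofList, ← Multiset.coe_eq_coe]
    simp
  rw [hg, hg, h]

theorem formalExp_pow {C : Type*} [CommRing C] [Algebra ℝ C] (a : C) (m : ℕ) :
    formalExp a ^ m = formalExp ((m : ℝ) • a) := by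
  induction m with
  | zero => simp
  | succ m ih =>
    rw [pow_succ, ih, formalExp_mul_comm]
    congr 1
    push_cast
    module

/-- All factors of `S_{2k}` are rescaled copies of `S₂` with scaling factors in `[-1, 1]`. -/
theorem seriesDominated_formalSuzuki (k : ℕ) :
    SeriesDominated (formalSuzuki (letter (L := L)) (k + 1)) (formalSuzukiTwo letter ^ 5 ^ k) := by
  induction k with
  | zero =>
    have h : ∀ j : Fin L, SeriesDominated (formalExp ((1 / 2 : ℝ) • letter j))
        (formalExp ((1 / 2 : ℝ) • letter j)) := fun j =>
      SeriesDominated.formalExp ((Dominated.of _).smul_smul (by norm_num))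
    rw [pow_zero, pow_one, formalSuzuki, formalSuzukiTwo, ← List.map_reverse]
    exact (SeriesDominated.list_prod _ _ _ h).mul (SeriesDominated.list_prod _ _ _ h)
  | succ k ih =>
    obtain ⟨h0, h1⟩ := suzukiCoeff_bounds k
    have hp := ih.dilate (c := suzukiCoeff (k + 2)) (by rw [abs_le]; constructor <;> linarith)
    have hq := ih.dilate (c := 1 - 4 * suzukiCoeff (k + 2))
      (by rw [abs_le]; constructor <;> linarith)
    have h := ((hp.pow 2).mul hq).mul (hp.pow 2)
    convert! h using 1
    rw [← pow_succ, ← pow_add, ← pow_mul]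
    congr 1

theorem abelianize_coeff_formalSuzuki (k s : ℕ) :
    abelianize (coeff s (formalSuzuki (letter (L := L)) (k + 1))) =
      abelianize (coeff s (formalExp (∑ j, letter (L := L) j))) := by
  have h1 := congrArg (coeff s) (map_formalSuzuki (abelianize (L := L)) letter (k + 1))
  have h2 := congrArg (coeff s) (map_formalExp (abelianize (L := L)) (∑ j, letter j))
  rw [coeff_map] at h1 h2
  rw [formalSuzuki_comm] at h1
  rw [map_sum] at h2
  exact h1.trans h2.symm

theorem abelianize_coeff_majorant (N s : ℕ) :
    abelianize (coeff s (formalSuzukiTwo (letter (L := L)) ^ N)) =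
      abelianize (((N : ℝ) ^ s * (s ! : ℝ)⁻¹) • (∑ j, letter (L := L) j) ^ s) := by
  have h1 := congrArg (fun P => coeff s (P ^ N)) (map_formalSuzukiTwo (abelianize (L := L)) letter)
  simp only [← map_pow] at h1
  rw [coeff_map, formalSuzukiTwo_comm, formalExp_pow, coeff_formalExp] at h1
  refine h1.trans ?_
  rw [map_smul, map_pow, map_sum, smul_pow, smul_smul, mul_comm]
  rfl

theorem sum_letter_pow (s : ℕ) :
    (∑ j, letter (L := L) j) ^ s =
      ∑ v : Fin s → Fin L, MonoidAlgebra.of ℝ _ (FreeMonoid.ofList (List.ofFn v)) := by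
  induction s with
  | zero => simp; rfl
  | succ s ih =>
    rw [pow_succ', ih, Finset.sum_mul_sum, ← (Fin.consEquiv fun _ => Fin L).sum_comp,
      Fintype.sum_prod_type]
    refine Finset.sum_congr rfl fun j _ => Finset.sum_congr rfl fun v _ => ?_
    rw [letter, ← map_mul]
    simp [Fin.consEquiv, List.ofFn_succ, FreeMonoid.ofList_cons]

/-- At most `C(s,2) L^{s-1}` of the `L^s` words of length `s` repeat a letter. -/
theorem pow_le_descFactorial_add (L s : ℕ) :
    L ^ s ≤ L.descFactorial s + s.choose 2 * L ^ (s - 1) := by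
  induction s with
  | zero => simp
  | succ s ih =>
    rcases s.eq_zero_or_pos with rfl | hs
    · simp
    have h1 : L ≤ (L - s) + s := by omega
    have h2 : L.descFactorial s ≤ L ^ s := Nat.descFactorial_le_pow L s
    have h3 : L ^ s = L ^ (s - 1) * L := by rw [← pow_succ]; congr 1; omega
    rw [Nat.descFactorial_succ, Nat.choose_succ_succ' s 1, Nat.choose_one_right, Nat.add_sub_cancel]
    calc L ^ (s + 1) = L ^ s * L := pow_succ _ _
      _ ≤ (L.descFactorial s + s.choose 2 * L ^ (s - 1)) * L := Nat.mul_le_mul_right _ ih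
      _ = L.descFactorial s * L + s.choose 2 * L ^ s := by rw [add_mul, h3, mul_assoc]
      _ ≤ L.descFactorial s * ((L - s) + s) + s.choose 2 * L ^ s := by gcongr
      _ = (L - s) * L.descFactorial s + (s * L.descFactorial s + s.choose 2 * L ^ s) := by ring
      _ ≤ (L - s) * L.descFactorial s + (s * L ^ s + s.choose 2 * L ^ s) := by gcongr
      _ = _ := by ring

theorem card_not_injective_le (L s : ℕ) :
    (Finset.univ.filter fun v : Fin s → Fin L => ¬ Function.Injective v).card ≤
      s.choose 2 * L ^ (s - 1) := by
  classical
  have h1 := Finset.card_filter_add_card_filter_not (s := (Finset.univ : Finset (Fin s → Fin L)))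
    (fun v => Function.Injective v)
  have h2 : (Finset.univ.filter fun v : Fin s → Fin L => Function.Injective v).card =
      L.descFactorial s := by
    rw [← Fintype.card_subtype, Fintype.card_congr (Equiv.subtypeInjectiveEquivEmbedding _ _),
      Fintype.card_embedding_eq]
    simp
  have h3 := pow_le_descFactorial_add L s
  simp only [Finset.card_univ, Fintype.card_pi, Fintype.card_fin, Finset.prod_const] at h1
  omega

/-- The total weight `Λ^s` of the words of length `s`. -/
theorem pairing_pow_length (Λ : ℝ) (s : ℕ) :
    pairing (fun w : FreeMonoid (Fin L) => Λ ^ w.toList.length) ((∑ j, letter j) ^ s) =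
      (L * Λ) ^ s := by
  rw [sum_letter_pow, map_sum]
  simp only [pairing_of]
  simp [mul_pow]

theorem pairing_repeated_le {Λ : ℝ} (hΛ : 0 ≤ Λ) (s : ℕ) :
    pairing (fun w : FreeMonoid (Fin L) => if w.toList.Nodup then 0 else Λ ^ w.toList.length)
      ((∑ j, letter j) ^ s) ≤ s.choose 2 * (L : ℝ) ^ (s - 1) * Λ ^ s := by
  rw [sum_letter_pow, map_sum]
  simp only [pairing_of, FreeMonoid.toList_ofList, List.nodup_ofFn, List.length_ofFn]
  have : ∀ v : Fin s → Fin L, (if Function.Injective v then 0 else Λ ^ s) =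
      if ¬ Function.Injective v then Λ ^ s else 0 := fun v => by split_ifs <;> rfl
  simp only [this]
  rw [← Finset.sum_filter, Finset.sum_const, nsmul_eq_mul]
  refine mul_le_mul_of_nonneg_right ?_ (pow_nonneg hΛ s)
  exact_mod_cast card_not_injective_le L s

/-! ### Coefficient bounds -/

section Bounds

variable {A : Type*} [NormedRing A] [NormedAlgebra ℝ A] {Λ : ℝ}

/-- The hypothesis `‖1‖ ≤ 1`, in place of `‖1‖ = 1`, admits matrices over an empty index type. -/
theorem norm_lift_word_le {A : Type*} [NormedRing A] {Λ : ℝ} (h1 : ‖(1 : A)‖ ≤ 1)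
    {y : Fin L → A} (hy : ∀ j, ‖y j‖ ≤ Λ)
    (w : FreeMonoid (Fin L)) : ‖FreeMonoid.lift y w‖ ≤ Λ ^ w.toList.length := by
  induction w using FreeMonoid.inductionOn' with
  | one => simpa using h1
  | of_mul j w ih =>
    have hΛ : 0 ≤ Λ := (norm_nonneg _).trans (hy j)
    rw [map_mul, FreeMonoid.lift_eval_of, FreeMonoid.toList_of_mul, List.length_cons, pow_succ']
    exact (norm_mul_le _ _).trans (mul_le_mul (hy j) ih (norm_nonneg _) hΛ)

theorem coeff_formalSuzuki_eq_substitute (y : Fin L → A) (k s : ℕ) :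
    coeff s (formalSuzuki y k) = substitute y (coeff s (formalSuzuki letter k)) := by
  have h := congrArg (coeff s) (map_formalSuzuki (substitute y) letter k)
  rw [substitute_comp_letter, coeff_map] at h
  exact h.symm

theorem coeff_formalExp_sum_eq_substitute (y : Fin L → A) (s : ℕ) :
    coeff s (formalExp (∑ j, y j)) =
      substitute y (coeff s (formalExp (∑ j, letter (L := L) j))) := by
  have h := congrArg (coeff s) (map_formalExp (substitute y) (∑ j, letter j))
  rw [coeff_map, map_sum] at h
  have h2 : ∀ j, substitute y (letter j) = y j := fun j => congrFun (substitute_comp_letter y) j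
  simp only [h2] at h
  exact h.symm

/-- Functionals that ignore the order of letters take the value `Nˢ / s!` times that of
`(∑ letters)ˢ` on the majorant. -/
theorem pairing_majorant {f : FreeMonoid (Fin L) → ℝ}
    (hf : ∀ v w, v.toList.Perm w.toList → f v = f w) (N s : ℕ) :
    pairing f (coeff s (formalSuzukiTwo letter ^ N)) =
      (N : ℝ) ^ s * (s ! : ℝ)⁻¹ * pairing f ((∑ j, letter j) ^ s) := by
  rw [pairing_eq_of_abelianize_eq hf (abelianize_coeff_majorant N s), map_smul, smul_eq_mul]

theorem norm_coeff_formalSuzuki_le (h1 : ‖(1 : A)‖ ≤ 1) {y : Fin L → A} (hy : ∀ j, ‖y j‖ ≤ Λ)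
    (k s : ℕ) :
    ‖coeff s (formalSuzuki y (k + 1))‖ ≤ (5 ^ k * (L * Λ)) ^ s / (s ! : ℝ) := by
  rw [coeff_formalSuzuki_eq_substitute, substitute, ← pairing_monoidHom]
  refine ((seriesDominated_formalSuzuki k s).norm_pairing_le (norm_lift_word_le h1 hy)).trans ?_
  rw [pairing_majorant (fun v w h => by rw [h.length_eq]), pairing_pow_length]
  push_cast
  rw [mul_pow, div_eq_mul_inv]
  exact le_of_eq (by ring)

theorem dominated_coeff_formalExp_sum_letter (s : ℕ) :
    Dominated (coeff s (formalExp (∑ j, letter (L := L) j)))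
      (coeff s (formalExp (∑ j, letter (L := L) j))) :=
  SeriesDominated.formalExp (Dominated.sum _ _ _ fun _ _ => Dominated.of _) s

theorem norm_coeff_formalExp_sum_le (h1 : ‖(1 : A)‖ ≤ 1) {y : Fin L → A} (hy : ∀ j, ‖y j‖ ≤ Λ)
    (s : ℕ) :
    ‖coeff s (formalExp (∑ j, y j))‖ ≤ (L * Λ) ^ s / (s ! : ℝ) := by
  rw [coeff_formalExp_sum_eq_substitute, substitute, ← pairing_monoidHom]
  refine ((dominated_coeff_formalExp_sum_letter s).norm_pairing_le
    (norm_lift_word_le h1 hy)).trans ?_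
  rw [coeff_formalExp, map_smul, pairing_pow_length, smul_eq_mul, div_eq_mul_inv, mul_comm]

/-- The average over all relabellings of the letters of the value of a word. -/
def averageWord (y : Fin L → A) (w : FreeMonoid (Fin L)) : A :=
  (1 / (L ! : ℝ)) • ∑ σ : Equiv.Perm (Fin L), FreeMonoid.lift (y ∘ σ) w

theorem norm_averageWord_le (h1 : ‖(1 : A)‖ ≤ 1) {y : Fin L → A} (hy : ∀ j, ‖y j‖ ≤ Λ)
    (w : FreeMonoid (Fin L)) : ‖averageWord y w‖ ≤ Λ ^ w.toList.length := by
  have h := norm_sum_le_of_le (Finset.univ : Finset (Equiv.Perm (Fin L)))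
    fun σ _ => norm_lift_word_le h1 (y := y ∘ σ) (fun j => hy _) w
  rw [averageWord, norm_smul]
  refine (mul_le_mul_of_nonneg_left h (norm_nonneg _)).trans (le_of_eq ?_)
  simp [Fintype.card_perm]
  field_simp

/-- The symmetric group is transitive on the words of a given length without repeated letters, so
they all have the same average. -/
theorem averageWord_eq_of_nodup (y : Fin L → A) {v w : FreeMonoid (Fin L)}
    (hv : v.toList.Nodup) (hw : w.toList.Nodup) (hl : v.toList.length = w.toList.length) :
    averageWord y v = averageWord y w := by
  obtain ⟨ρ, hρ⟩ : ∃ ρ : Equiv.Perm (Fin L), v.toList = w.toList.map ρ := by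
    have h : ∀ u : List (Fin L), u.length = v.toList.length → u.Nodup →
        ∃ e : Fin v.toList.length ↪ Fin L, List.ofFn e = u := by
      rintro u hu hn
      refine ⟨⟨fun i => u.get (i.cast hu.symm), fun i j hij => ?_⟩, ?_⟩
      · simpa using List.nodup_iff_injective_get.1 hn hij
      · refine List.ext_get (by simp [hu]) fun i _ _ => ?_
        simp only [List.get_eq_getElem, List.getElem_ofFn]
        rfl
    obtain ⟨e, he⟩ := h _ rfl hv
    obtain ⟨e', he'⟩ := h _ hl.symm hw
    obtain ⟨ρ, hρ⟩ := Equiv.Perm.exists_smul_eq_embedding e' e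
    refine ⟨ρ, ?_⟩
    rw [← he, ← he', ← hρ, List.map_ofFn]
    rfl
  have h : ∀ σ : Equiv.Perm (Fin L),
      FreeMonoid.lift (y ∘ σ) v = FreeMonoid.lift (y ∘ (σ * ρ)) w := by
    intro σ
    rw [FreeMonoid.lift_apply, FreeMonoid.lift_apply, hρ, List.map_map]
    rfl
  simp only [averageWord, h]
  congr 1
  exact Fintype.sum_equiv (Equiv.mulRight ρ) _ (fun σ => FreeMonoid.lift (y ∘ σ) w) fun σ => rfl

/-- Averaging over the permutations removes the contributions of all words without repeated
letters, which leaves a fraction of order `1 / L` of the words. -/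
theorem norm_average_coeff_sub_le (h1 : ‖(1 : A)‖ ≤ 1) {y : Fin L → A} (hΛ : 0 ≤ Λ)
    (hy : ∀ j, ‖y j‖ ≤ Λ) (k s : ℕ) :
    ‖(1 / (L ! : ℝ)) • ∑ σ : Equiv.Perm (Fin L),
      (coeff s (formalSuzuki (y ∘ σ) (k + 1)) - coeff s (formalExp (∑ j, y j)))‖ ≤
      ((5 ^ k) ^ s + 1) * (s.choose 2 * (L : ℝ) ^ (s - 1) * Λ ^ s) / (s ! : ℝ) := by
  set c := coeff s (formalSuzuki (letter (L := L)) (k + 1))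
  set d := coeff s (formalExp (∑ j, letter (L := L) j))
  let F : FreeMonoid (Fin L) → A := fun w => if w.toList.Nodup then averageWord y w else 0
  let G : FreeMonoid (Fin L) → A := fun w => if w.toList.Nodup then 0 else averageWord y w
  let g : FreeMonoid (Fin L) → ℝ := fun w => if w.toList.Nodup then 0 else Λ ^ w.toList.length
  have hFG : averageWord y = fun w => F w + G w := by
    funext w
    by_cases h : w.toList.Nodup <;> simp [F, G, h]
  have hF : ∀ v w, v.toList.Perm w.toList → F v = F w := by
    intro v w h
    by_cases hv : v.toList.Nodup
    · have hw := h.nodup_iff.1 hv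
      simp only [F, hv, hw, if_true]
      exact averageWord_eq_of_nodup y hv hw h.length_eq
    · have hw : ¬ w.toList.Nodup := fun hw => hv (h.nodup_iff.2 hw)
      simp only [F, hv, hw, if_false]
  have hg : ∀ v w, v.toList.Perm w.toList → g v = g w := by
    intro v w h
    simp only [g, h.nodup_iff, h.length_eq]
  have e1 : (1 / (L ! : ℝ)) • ∑ σ : Equiv.Perm (Fin L),
      (coeff s (formalSuzuki (y ∘ σ) (k + 1)) - coeff s (formalExp (∑ j, y j))) =
      pairing (averageWord y) (c - d) := by
    have h2 : ∀ σ : Equiv.Perm (Fin L),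
        coeff s (formalSuzuki (y ∘ σ) (k + 1)) - coeff s (formalExp (∑ j, y j)) =
          pairing (FreeMonoid.lift (y ∘ σ)) (c - d) := by
      intro σ
      rw [pairing_monoidHom, ← Equiv.sum_comp σ y, coeff_formalSuzuki_eq_substitute]
      have := coeff_formalExp_sum_eq_substitute (y ∘ σ) s
      simp only [Function.comp_apply] at this
      rw [this, ← map_sub]
      rfl
    simp only [h2]
    exact (pairing_smul_sum_left _ _ _ _).symm
  have e2 : pairing F (c - d) = 0 := by
    rw [map_sub, pairing_eq_of_abelianize_eq hF (abelianize_coeff_formalSuzuki k s), sub_self]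
  rw [e1, hFG, pairing_add_left, e2, zero_add]
  have hG : ∀ w, ‖G w‖ ≤ g w := by
    intro w
    by_cases h : w.toList.Nodup
    · simp [G, g, h]
    · simpa [G, g, h] using norm_averageWord_le h1 hy w
  refine (((seriesDominated_formalSuzuki k s).sub
    (dominated_coeff_formalExp_sum_letter s)).norm_pairing_le hG).trans ?_
  rw [map_add, pairing_majorant hg, coeff_formalExp, map_smul, smul_eq_mul]
  have h3 := pairing_repeated_le (L := L) hΛ s
  have h4 : (0 : ℝ) ≤ ((5 ^ k) ^ s + 1) * (s ! : ℝ)⁻¹ := by positivity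
  refine le_trans (le_of_eq ?_) ((mul_le_mul_of_nonneg_left h3 h4).trans (le_of_eq ?_))
  · push_cast
    ring
  · ring

end Bounds

end Words

section Analytic

open PowerSeries Finset

/-! ### Convergence of the formal series -/

section Convergence

variable {A : Type*} [NormedRing A] [NormedAlgebra ℂ A]

/-- The formal series `P` converges absolutely everywhere, with sum `f`. -/
def Represents (P : A⟦X⟧) (f : ℂ → A) : Prop :=
  ∀ z, (Summable fun s => ‖z ^ s • coeff s P‖) ∧ HasSum (fun s => z ^ s • coeff s P) (f z)

namespace Represents

variable {P Q : A⟦X⟧} {f g : ℂ → A}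

theorem one : Represents (1 : A⟦X⟧) fun _ => 1 := by
  intro z
  have h0 : ∀ s, s ∉ ({0} : Finset ℕ) → z ^ s • coeff s (1 : A⟦X⟧) = 0 := by
    intro s hs
    rw [coeff_one, if_neg (by simpa using hs), smul_zero]
  refine ⟨summable_of_ne_finset_zero (s := {0}) fun s hs => by rw [h0 s hs, norm_zero], ?_⟩
  simpa using hasSum_sum_of_ne_finset_zero h0

protected theorem dilate (hP : Represents P f) (c : ℝ) :
    Represents (dilate c P) fun z => f (c * z) := by
  intro z
  have e : ∀ s, z ^ s • coeff s (dilate c P) = ((c : ℂ) * z) ^ s • coeff s P := by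
    intro s
    rw [coeff_dilate, ← Complex.coe_smul, smul_smul, mul_pow, mul_comm, Complex.ofReal_pow]
  simp only [e]
  exact hP _

variable [CompleteSpace A]

protected theorem mul (hP : Represents P f) (hQ : Represents Q g) :
    Represents (P * Q) fun z => f z * g z := by
  intro z
  have e : ∀ s, z ^ s • coeff s (P * Q) =
      ∑ p ∈ antidiagonal s, (z ^ p.1 • coeff p.1 P) * (z ^ p.2 • coeff p.2 Q) := by
    intro s
    rw [coeff_mul, Finset.smul_sum]
    refine Finset.sum_congr rfl fun p hp => ?_
    rw [HasAntidiagonal.mem_antidiagonal] at hp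
    rw [smul_mul_smul_comm, ← pow_add, hp]
  have h1 := summable_norm_sum_mul_antidiagonal_of_summable_norm (hP z).1 (hQ z).1
  have h2 := tsum_mul_tsum_eq_tsum_sum_antidiagonal_of_summable_norm (hP z).1 (hQ z).1
  rw [(hP z).2.tsum_eq, (hQ z).2.tsum_eq] at h2
  simp only [e, h2]
  exact ⟨h1, h1.of_norm.hasSum⟩

protected theorem pow (hP : Represents P f) (m : ℕ) : Represents (P ^ m) fun z => f z ^ m := by
  induction m with
  | zero => simpa using one
  | succ m ih => simpa only [pow_succ] using ih.mul hP

theorem list_prod {α : Type*} (l : List α) (F : α → A⟦X⟧) (φ' : α → ℂ → A)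
    (h : ∀ a, Represents (F a) (φ' a)) :
    Represents (l.map F).prod fun z => (l.map fun a => φ' a z).prod := by
  induction l with
  | nil => simpa using one
  | cons a l ih => simpa using (h a).mul ih

protected theorem formalExp (a : A) :
    Represents (formalExp a) fun z => NormedSpace.exp (z • a) := by
  intro z
  have e : ∀ s : ℕ, z ^ s • coeff s (formalExp a) = (s !⁻¹ : ℂ) • (z • a) ^ s := by
    intro s
    rw [coeff_formalExp, ← Complex.coe_smul, smul_smul, smul_pow, smul_smul, mul_comm,
      Complex.ofReal_inv, Complex.ofReal_natCast]
  simp only [e]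
  exact ⟨NormedSpace.norm_expSeries_summable' (z • a), NormedSpace.exp_series_hasSum_exp' (z • a)⟩

end Represents

variable [CompleteSpace A] {L : ℕ}

/-- The Suzuki formula of order `2k` with summands `y j`, in a Banach algebra; the recursion is that
of `suzuki`. -/
def banachSuzuki (y : Fin L → A) : ℕ → ℂ → A
  | 0, _ => 1
  | 1, z => (List.ofFn fun j => NormedSpace.exp ((z / 2) • y j)).prod *
      (List.ofFn fun j => NormedSpace.exp ((z / 2) • y j)).reverse.prod
  | k + 2, z =>
      banachSuzuki y (k + 1) ((suzukiCoeff (k + 2) : ℂ) * z) ^ 2 *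
        banachSuzuki y (k + 1) ((1 - 4 * (suzukiCoeff (k + 2) : ℂ)) * z) *
        banachSuzuki y (k + 1) ((suzukiCoeff (k + 2) : ℂ) * z) ^ 2

theorem represents_formalSuzuki (y : Fin L → A) (k : ℕ) :
    Represents (formalSuzuki y k) (banachSuzuki y k) := by
  induction k using Nat.twoStepInduction with
  | zero => exact Represents.one
  | one =>
    have h : ∀ j, Represents (formalExp ((1 / 2 : ℝ) • y j))
        fun z => NormedSpace.exp ((z / 2) • y j) := by
      intro j
      convert! Represents.formalExp ((1 / 2 : ℝ) • y j) using 1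
      funext z
      rw [← Complex.coe_smul, smul_smul]
      congr 2
      push_cast
      ring
    have h1 := (Represents.list_prod (List.finRange L) _ _ h).mul
      (Represents.list_prod (List.finRange L).reverse _ _ h)
    simp only [List.map_reverse, ← List.ofFn_eq_map] at h1
    simp only [formalSuzuki, formalSuzukiTwo, ← List.ofFn_eq_map]
    exact h1
  | more k _ ih =>
    have hp := (ih.dilate (suzukiCoeff (k + 2))).pow 2
    have hq := ih.dilate (1 - 4 * suzukiCoeff (k + 2))
    have h := (hp.mul hq).mul hp
    push_cast at h
    exact h

/-! ### Remainder estimates -/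

theorem inv_factorial_add_le (s m : ℕ) :
    ((s + m)! : ℝ)⁻¹ ≤ (s ! : ℝ)⁻¹ * (m ! : ℝ)⁻¹ := by
  rw [← mul_inv]
  have h : s ! * m ! ≤ (s + m)! :=
    Nat.le_of_dvd (Nat.factorial_pos _) (Nat.factorial_mul_factorial_dvd_factorial_add s m)
  apply inv_anti₀ (by positivity)
  exact_mod_cast h

/-- The sum of a series that starts at order `m` and is majorized by `C zᵐ exp(Y z)`. -/
theorem norm_le_of_hasSum_tail {A : Type*} [NormedRing A] [NormedAlgebra ℂ A] {d : ℕ → A}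
    {z : ℂ} {D : A} {m : ℕ} {C Y : ℝ}
    (hD : HasSum (fun s => z ^ s • d s) D) (h0 : ∀ s < m, d s = 0)
    (hd : ∀ s, ‖d (s + m)‖ ≤ C * (Y ^ s * (s ! : ℝ)⁻¹)) :
    ‖D‖ ≤ ‖z‖ ^ m * C * Real.exp (‖z‖ * Y) := by
  have h1 : HasSum (fun s => z ^ (s + m) • d (s + m)) D := by
    refine (hasSum_nat_add_iff (f := fun s => z ^ s • d s) m).2 ?_
    rw [Finset.sum_eq_zero fun s hs => by rw [h0 s (Finset.mem_range.1 hs), smul_zero], add_zero]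
    exact hD
  have h2 : HasSum (fun s : ℕ => ‖z‖ ^ m * C * ((s ! : ℝ)⁻¹ • (‖z‖ * Y) ^ s))
      (‖z‖ ^ m * C * Real.exp (‖z‖ * Y)) := by
    rw [Real.exp_eq_exp_ℝ]
    exact (NormedSpace.exp_series_hasSum_exp' (𝕂 := ℝ) (‖z‖ * Y)).mul_left _
  rw [← h1.tsum_eq]
  refine tsum_of_norm_bounded h2 fun s => ?_
  rw [norm_smul, norm_pow, smul_eq_mul]
  refine (mul_le_mul_of_nonneg_left (hd s) (by positivity)).trans (le_of_eq ?_)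
  rw [pow_add, mul_pow]
  ring

/-- Each single product formula `S_{2k+2}` has an error of order `2k + 3`. -/
theorem norm_banachSuzuki_sub_exp_le (h1 : ‖(1 : A)‖ ≤ 1) {Λ : ℝ} (hΛ : 0 ≤ Λ) {y : Fin L → A}
    (hy : ∀ j, ‖y j‖ ≤ Λ) (k : ℕ) (z : ℂ) :
    ‖banachSuzuki y (k + 1) z - NormedSpace.exp (z • ∑ j, y j)‖ ≤
      ‖z‖ ^ (2 * k + 3) * (2 * (5 ^ k * (L * Λ)) ^ (2 * k + 3) * ((2 * k + 3)! : ℝ)⁻¹) *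
        Real.exp (‖z‖ * (5 ^ k * (L * Λ))) := by
  have hD := (represents_formalSuzuki y (k + 1) z).2.sub (Represents.formalExp (∑ j, y j) z).2
  simp only [← smul_sub] at hD
  refine norm_le_of_hasSum_tail hD
    (fun s hs => sub_eq_zero.2 (coeff_formalSuzuki_eq y k s hs)) fun s => ?_
  have h2 := norm_coeff_formalSuzuki_le h1 hy k (s + (2 * k + 3))
  have h3 := norm_coeff_formalExp_sum_le h1 hy (s + (2 * k + 3))
  have hQ : (1 : ℝ) ≤ 5 ^ k := one_le_pow₀ (by norm_num)
  have hx : 0 ≤ (L : ℝ) * Λ := by positivity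
  have h4 : ((L : ℝ) * Λ) ^ (s + (2 * k + 3)) ≤ (5 ^ k * (L * Λ)) ^ (s + (2 * k + 3)) :=
    pow_le_pow_left₀ hx (le_mul_of_one_le_left hx hQ) _
  set x := (5 : ℝ) ^ k * (L * Λ)
  have hx' : 0 ≤ x := by positivity
  set m := 2 * k + 3
  have h5 : ((L : ℝ) * Λ) ^ (s + m) / ((s + m)! : ℝ) ≤ x ^ (s + m) / ((s + m)! : ℝ) := by
    gcongr
  have h6 : x ^ (s + m) / ((s + m)! : ℝ) ≤ x ^ (s + m) * ((s ! : ℝ)⁻¹ * (m ! : ℝ)⁻¹) := by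
    rw [div_eq_mul_inv]
    exact mul_le_mul_of_nonneg_left (inv_factorial_add_le s m) (by positivity)
  have h7 := norm_sub_le (coeff (s + m) (formalSuzuki y (k + 1)))
    (coeff (s + m) (formalExp (∑ j, y j)))
  refine h7.trans ((add_le_add h2 (h3.trans h5)).trans ?_)
  refine (add_le_add h6 h6).trans (le_of_eq ?_)
  rw [pow_add]
  ring

theorem choose_two_mul_inv_factorial (N : ℕ) :
    ((N + 2).choose 2 : ℝ) * ((N + 2)! : ℝ)⁻¹ = 1 / 2 * (N ! : ℝ)⁻¹ := by
  have h : ((N + 2).choose 2 : ℝ) * 2 * (N ! : ℝ) = ((N + 2)! : ℝ) := by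
    have := Nat.choose_mul_factorial_mul_factorial (show 2 ≤ N + 2 by omega)
    rw [Nat.add_sub_cancel] at this
    exact_mod_cast this
  have h1 := Nat.factorial_ne_zero (N + 2)
  have h2 := Nat.factorial_ne_zero N
  field_simp
  linarith

/-- The average of the formulas `S_{2k+2}` over all orderings has an error of order `2k + 3` with only
`2k + 2` factors of `L`. -/
theorem norm_average_banachSuzuki_sub_exp_le (h1 : ‖(1 : A)‖ ≤ 1) {Λ : ℝ} (hΛ : 0 ≤ Λ)
    {y : Fin L → A} (hy : ∀ j, ‖y j‖ ≤ Λ) (k : ℕ) (z : ℂ) :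
    ‖(1 / (L ! : ℂ)) • ∑ σ : Equiv.Perm (Fin L),
      (banachSuzuki (y ∘ σ) (k + 1) z - NormedSpace.exp (z • ∑ j, y j))‖ ≤
      ‖z‖ ^ (2 * k + 3) *
        ((5 ^ k * Λ) ^ (2 * k + 3) * (L : ℝ) ^ (2 * k + 2) * ((2 * k + 1)! : ℝ)⁻¹) *
        Real.exp (‖z‖ * (5 ^ k * (L * Λ))) := by
  have hD : HasSum (fun s => z ^ s • ((1 / (L ! : ℝ)) • ∑ σ : Equiv.Perm (Fin L),
      (coeff s (formalSuzuki (y ∘ σ) (k + 1)) - coeff s (formalExp (∑ j, y j)))))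
      ((1 / (L ! : ℂ)) • ∑ σ : Equiv.Perm (Fin L),
      (banachSuzuki (y ∘ σ) (k + 1) z - NormedSpace.exp (z • ∑ j, y j))) := by
    have h := (hasSum_sum (s := (Finset.univ : Finset (Equiv.Perm (Fin L)))) fun σ _ =>
      (represents_formalSuzuki (y ∘ σ) (k + 1) z).2.sub
        (Represents.formalExp (∑ j, y j) z).2).const_smul (1 / (L ! : ℂ))
    convert! h using 1
    funext s
    rw [← Complex.coe_smul, smul_comm, Finset.smul_sum]
    simp only [smul_sub]
    push_cast
    rfl
  refine norm_le_of_hasSum_tail hD (fun s hs => ?_) fun s => ?_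
  · rw [Finset.sum_eq_zero, smul_zero]
    intro σ _
    rw [coeff_formalSuzuki_eq _ k s hs]
    simp only [Function.comp_apply, Equiv.sum_comp σ y, sub_self]
  · refine (norm_average_coeff_sub_le h1 hΛ hy k _).trans ?_
    have hQ : (1 : ℝ) ≤ (5 ^ k) ^ (s + (2 * k + 3)) :=
      one_le_pow₀ (one_le_pow₀ (by norm_num))
    have h2 := choose_two_mul_inv_factorial (s + (2 * k + 1))
    have h3 := inv_factorial_add_le s (2 * k + 1)
    rw [show s + (2 * k + 1) + 2 = s + (2 * k + 3) by ring] at h2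
    have e : s + (2 * k + 3) - 1 = s + (2 * k + 2) := by omega
    rw [e]
    set q : ℝ := 5 ^ k
    set m := 2 * k + 3
    have hLΛ : 0 ≤ (L : ℝ) ^ (s + (2 * k + 2)) * Λ ^ (s + m) := by positivity
    calc (q ^ (s + m) + 1) * (((s + m).choose 2 : ℝ) * (L : ℝ) ^ (s + (2 * k + 2)) * Λ ^ (s + m)) /
          ((s + m)! : ℝ)
        = (q ^ (s + m) + 1) * (((s + m).choose 2 : ℝ) * ((s + m)! : ℝ)⁻¹) *
            ((L : ℝ) ^ (s + (2 * k + 2)) * Λ ^ (s + m)) := by ring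
      _ = (q ^ (s + m) + 1) * (1 / 2 * ((s + (2 * k + 1))! : ℝ)⁻¹) *
            ((L : ℝ) ^ (s + (2 * k + 2)) * Λ ^ (s + m)) := by rw [h2]
      _ ≤ (q ^ (s + m) + q ^ (s + m)) * (1 / 2 * ((s ! : ℝ)⁻¹ * ((2 * k + 1)! : ℝ)⁻¹)) *
            ((L : ℝ) ^ (s + (2 * k + 2)) * Λ ^ (s + m)) := by gcongr
      _ = _ := by
        rw [pow_add q, pow_add (L : ℝ), pow_add Λ]
        ring

end Convergence

end Analytic

/-! ### Unitarity and the diamond-norm bound -/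

section Unitary

open scoped Matrix.Norms.L2Operator

variable {n : Type*} [Fintype n] [DecidableEq n] {L : ℕ}

theorem suzuki_eq_banachSuzuki (H : Fin L → Matrix n n ℂ) (σ : Equiv.Perm (Fin L)) (k : ℕ) (z : ℂ) :
    suzuki H σ k z = banachSuzuki (H ∘ σ) k z := by
  induction k using Nat.twoStepInduction generalizing z with
  | zero => rfl
  | one => rfl
  | more k _ ih => simp only [suzuki, banachSuzuki, ih]

theorem exp_smul_mem_unitary {z : ℂ} (hz : star z = -z) {B : Matrix n n ℂ} (hB : B.IsHermitian) :
    NormedSpace.exp (z • B) ∈ unitary (Matrix n n ℂ) := by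
  let _ : NormedAlgebra ℚ (Matrix n n ℂ) := NormedAlgebra.restrictScalars ℚ ℂ _
  refine NormedSpace.exp_mem_unitary_of_mem_skewAdjoint ?_
  rw [skewAdjoint.mem_iff, star_smul, hz, Matrix.star_eq_conjTranspose, hB.eq, neg_smul]

theorem suzuki_mem_unitary {H : Fin L → Matrix n n ℂ} (hH : ∀ j, (H j).IsHermitian)
    (σ : Equiv.Perm (Fin L)) (k : ℕ) {z : ℂ} (hz : star z = -z) :
    suzuki H σ k z ∈ unitary (Matrix n n ℂ) := by
  induction k using Nat.twoStepInduction generalizing z with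
  | zero => exact one_mem _
  | one =>
    have h2 : star (z / 2) = -(z / 2) := by
      rw [star_div₀, hz]
      simp [neg_div]
    have h : ∀ j, NormedSpace.exp ((z / 2) • H (σ j)) ∈ unitary (Matrix n n ℂ) :=
      fun j => exp_smul_mem_unitary h2 (hH _)
    refine mul_mem (list_prod_mem ?_) (list_prod_mem ?_) <;> simpa using h
  | more k _ ih =>
    have h : ∀ c : ℝ, star ((c : ℂ) * z) = -((c : ℂ) * z) := fun c => by
      rw [star_mul', hz]
      simp
    have h' := ih (h (1 - 4 * suzukiCoeff (k + 2)))
    push_cast at h'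
    exact mul_mem (mul_mem (pow_mem (ih (h _)) 2) h') (pow_mem (ih (h _)) 2)

end Unitary

end ProductFormula

end

theorem theorem2 {n : Type*} [Fintype n] [DecidableEq n] {L : ℕ}
    (H : Fin L → Matrix n n ℂ) (hH : ∀ j, (H j).IsHermitian)
    (Λ : ℝ) (hΛ : IsGreatest (Set.range fun j => ProductFormula.spectralNorm (H j)) Λ)
    (k : ℕ) (hk : 1 ≤ k) (r : ℕ) (hr : 1 ≤ r) (t : ℝ) :
    ProductFormula.diamondNorm
        (ProductFormula.channel (ProductFormula.idealEvolution H (-Complex.I * (t : ℂ))) -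
          ProductFormula.averageChannel H k (-Complex.I * (t : ℂ) / (r : ℂ)) ^ r) ≤
      4 * ((2 * 5 ^ (k - 1) * Λ * |t| * (L : ℝ)) ^ (4 * k + 2) /
            (((2 * k + 1)! : ℝ) ^ 2 * (r : ℝ) ^ (4 * k + 1))) *
          Real.exp (4 * 5 ^ (k - 1) * (Λ * |t| * (L : ℝ) / (r : ℝ))) +
        2 * ((2 * 5 ^ (k - 1) * Λ * |t|) ^ (2 * k + 1) * (L : ℝ) ^ (2 * k) /
            (((2 * k - 1)! : ℝ) * (r : ℝ) ^ (2 * k))) *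
          Real.exp (2 * 5 ^ (k - 1) * (Λ * |t| * (L : ℝ) / (r : ℝ))) := by
  open ProductFormula Matrix.Norms.L2Operator in
  obtain ⟨k, rfl⟩ : ∃ k', k = k' + 1 := ⟨k - 1, by omega⟩
  have hr0 : (0 : ℝ) < r := by exact_mod_cast hr
  have hrC : (r : ℂ) ≠ 0 := by exact_mod_cast hr0.ne'
  have hy : ∀ j, ‖H j‖ ≤ Λ := fun j => hΛ.2 ⟨j, rfl⟩
  have hΛ0 : 0 ≤ Λ := by
    obtain ⟨j, hj⟩ := hΛ.1
    rw [← hj]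
    exact norm_nonneg _
  have h1 : ‖(1 : Matrix n n ℂ)‖ ≤ 1 := norm_le_one_of_mem_unitary (one_mem _)
  set z : ℂ := -Complex.I * (t : ℂ) / (r : ℂ) with hz
  have hzn : ‖z‖ = |t| / r := by simp [hz]
  have hzs : star z = -z := by
    simp [hz, neg_div]
  have hV : idealEvolution H z ∈ unitary (Matrix n n ℂ) :=
    exp_smul_mem_unitary hzs (by
      rw [Matrix.IsHermitian, Matrix.conjTranspose_sum]
      exact Finset.sum_congr rfl fun j _ => hH j)
  have hVr : idealEvolution H (-Complex.I * (t : ℂ)) = idealEvolution H z ^ r := by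
    let _ : NormedAlgebra ℚ (Matrix n n ℂ) := NormedAlgebra.restrictScalars ℚ ℂ _
    rw [idealEvolution, idealEvolution, ← NormedSpace.exp_nsmul, ← Nat.cast_smul_eq_nsmul ℂ,
      smul_smul, hz, mul_div_cancel₀ _ hrC]
  have hcard : Fintype.card (Equiv.Perm (Fin L)) = L ! := by simp [Fintype.card_perm]
  rw [hVr, channel_pow, averageChannel, ← hcard]
  refine (diamondNorm_channel_pow_sub_average_pow_le (fun σ => suzuki H σ (k + 1) z)
    (idealEvolution H z) (fun σ => norm_le_one_of_mem_unitary (suzuki_mem_unitary hH σ _ hzs))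
    (norm_le_one_of_mem_unitary hV)
    (a := ‖z‖ ^ (2 * k + 3) * (2 * (5 ^ k * (L * Λ)) ^ (2 * k + 3) * ((2 * k + 3)! : ℝ)⁻¹) *
        Real.exp (‖z‖ * (5 ^ k * (L * Λ))))
    (b := ‖z‖ ^ (2 * k + 3) *
        ((5 ^ k * Λ) ^ (2 * k + 3) * (L : ℝ) ^ (2 * k + 2) * ((2 * k + 1)! : ℝ)⁻¹) *
        Real.exp (‖z‖ * (5 ^ k * (L * Λ))))
    (fun σ => ?_) ?_ r).trans ?_
  · have h := norm_banachSuzuki_sub_exp_le h1 hΛ0 (y := H ∘ σ) (fun j => hy _) k z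
    simp only [Function.comp_apply, Equiv.sum_comp σ H] at h
    rw [suzuki_eq_banachSuzuki]
    exact h
  · rw [hcard]
    simp only [suzuki_eq_banachSuzuki]
    exact norm_average_banachSuzuki_sub_exp_le h1 hΛ0 hy k z
  · rw [hzn]
    have e1 : (2 * (k + 1) - 1) = 2 * k + 1 := by omega
    have e2 : 2 * (k + 1) + 1 = 2 * k + 3 := by ring
    have e3 : 4 * (k + 1) + 2 = 2 * (2 * k + 3) := by ring
    have e4 : 4 * (k + 1) + 1 = 4 * k + 5 := by ring
    have e5 : 2 * (k + 1) = 2 * k + 2 := by ring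
    rw [e1, e2, e3, e4, e5, Nat.add_sub_cancel]
    set q : ℝ := 5 ^ k with hq
    have hq0 : 0 ≤ q := by positivity
    set T := |t|
    have hT0 : 0 ≤ T := abs_nonneg t
    have hx0 : 0 ≤ Λ * T * L / r := by positivity
    set E := Real.exp (T / r * (q * (L * Λ))) with hE
    have hE1 : E ^ 2 ≤ Real.exp (4 * q * (Λ * T * L / r)) := by
      rw [hE, sq, ← Real.exp_add]
      apply Real.exp_le_exp.2
      have : T / r * (q * (L * Λ)) = q * (Λ * T * L / r) := by ring
      rw [this]
      nlinarith [mul_nonneg hq0 hx0]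
    have hE2 : E ≤ Real.exp (2 * q * (Λ * T * L / r)) := by
      apply Real.exp_le_exp.2
      have : T / r * (q * (L * Λ)) = q * (Λ * T * L / r) := by ring
      rw [this]
      nlinarith [mul_nonneg hq0 hx0]
    -- the estimates hold with `5 ^ k` in place of `2 * 5 ^ k`
    have p1 : (q * Λ * T * L) ^ (2 * (2 * k + 3)) ≤ (2 * q * Λ * T * L) ^ (2 * (2 * k + 3)) := by
      gcongr
      linarith
    have p2 : (q * Λ * T) ^ (2 * k + 3) ≤ (2 * q * Λ * T) ^ (2 * k + 3) := by
      gcongr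
      linarith
    rw [mul_add]
    refine add_le_add ?_ ?_
    · calc (r : ℝ) * ((T / r) ^ (2 * k + 3) *
              (2 * (q * (L * Λ)) ^ (2 * k + 3) * ((2 * k + 3)! : ℝ)⁻¹) * E) ^ 2
          = 4 * ((q * Λ * T * L) ^ (2 * (2 * k + 3)) /
              (((2 * k + 3)! : ℝ) ^ 2 * (r : ℝ) ^ (4 * k + 5))) * E ^ 2 := by
            have : (r : ℝ) ^ (4 * k + 5) * r = (r ^ (2 * k + 3)) ^ 2 := by
              rw [← pow_succ, ← pow_mul]; congr 1; ring
            rw [div_pow, pow_mul' (q * Λ * T * L)]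
            field_simp
            rw [← this]
            ring
        _ ≤ _ := by gcongr
    · calc (r : ℝ) * (2 * ((T / r) ^ (2 * k + 3) *
              ((q * Λ) ^ (2 * k + 3) * (L : ℝ) ^ (2 * k + 2) * ((2 * k + 1)! : ℝ)⁻¹) * E))
          = 2 * ((q * Λ * T) ^ (2 * k + 3) * (L : ℝ) ^ (2 * k + 2) /
              (((2 * k + 1)! : ℝ) * (r : ℝ) ^ (2 * k + 2))) * E := by
            have : (r : ℝ) ^ (2 * k + 3) = r ^ (2 * k + 2) * r := pow_succ _ _
            rw [div_pow, this]
            field_simp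
            ring
        _ ≤ _ := by gcongr
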